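/- All Hilbert spaces are finite-dimensional and $\log$ is to base $2$, with $\log 0=-\infty$. A sub-normalized state is an operator $\rho\ge 0$ with $0<\operatorname{tr}\rho\le 1$; it is normalized if $\operatorname{tr}\rho=1$. For sub-normalized states put $\bar F(\rho,\tau)=\operatorname{tr}|\sqrt\rho\sqrt\tau|+\sqrt{(1-\operatorname{tr}\rho)(1-\operatorname{tr}\tau)}$ and $P(\rho,\tau)=\sqrt{1-\bar F(\rho,\tau)^2}$, and let $\mathcal B^\varepsilon(\rho)$ be the set of sub-normalized states $\tilde\rho$ with $P(\rho,\tilde\rho)\le\varepsilon$. Let $D_{\max}(\rho\|\tau)=\inf\{\lambda\in\mathbb R:\rho\le 2^\lambda\tau\}$. For a sub-normalized state $\rho_{AB}$ on $\mathcal H_A\otimes\mathcal H_B$ and $\varepsilon\ge 0$, define the alternative min-entropy, its smooth version, the alternative smooth max-entropy and its non-smooth version by $$\hat H_{\min}(A|B)_\rho=-D_{\max}(\rho_{AB}\,\|\,1_A\otimes\rho_B),\qquad \hat H^{\varepsilon}_{\min}(A|B)_\rho=\max_{\tilde\rho_{AB}\in\mathcal B^\varepsilon(\rho_{AB})}\hat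 H_{\min}(A|B)_{\tilde\rho},$$ $$\hat H^{\varepsilon}_{\max}(A|B)_\rho=-\hat H^{\varepsilon}_{\min}(A|C)_\rho,\qquad \hat H_{\max}(A|B)_\rho=\lim_{\varepsilon\to 0^+}\hat H^{\varepsilon}_{\max}(A|B)_\rho,$$ where $\rho_{ABC}$ is any purification of $\rho_{AB}$ (with any purifying space $\mathcal H_C$). Lemma. Let $\rho_{AB}$ be a sub-normalized state. These quantities are well defined: for every $\varepsilon\ge0$ the maximum defining $\hat H^{\varepsilon}_{\min}$ is attained and $\hat H^{\varepsilon}_{\max}$ does not depend on the purification; moreover the limit defining $\hat H_{\max}$ exists. Furthermore: 1. For every $\varepsilon\ge 0$ and every isometry $U:\mathcal H_B\to\mathcal H_D$, with $\tau_{AD}=(1_A\otimes U)\rho_{AB}(1_A\otimes U^\dagger)$, $$\hat H^{\varepsilon}_{\min}(A|B)_\rho=\hat H^{\varepsilon}_{\min}(A|D)_\tau\quad\text{and}\quad \hat H^{\varepsilon}_{\max}(A|B)_\rho=\hat H^{\varepsilon}_{\max}(A|D)_\tau .$$ 2. With $\Pi_{\rho_{AB}}$ the projector onto the support of $\rho_{AB}$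 and the maximum (which is attained) over all normalized states $\sigma_B$ on $\mathcal H_B$, $$\hat H_{\max}(A|B)_\rho=\max_{\sigma_B}\ \log\operatorname{tr}\big(\Pi_{\rho_{AB}}(1_A\otimes\sigma_B)\big).$$ 3. For every $\varepsilon\ge 0$, $$\hat H^{\varepsilon}_{\max}(A|B)_\rho=\inf_{\mathcal H_{B'}\supseteq\mathcal H_B}\ \min_{\tilde\rho_{AB'}\in\mathcal B^\varepsilon(\rho_{AB'})}\hat H_{\max}(A|B')_{\tilde\rho},$$ where the infimum is over all isometric embeddings of $\mathcal H_B$ into finite-dimensional spaces $\mathcal H_{B'}$, $\rho_{AB'}$ is the corresponding embedding of $\rho_{AB}$, and every inner minimum is attained. The infimum is attained by every embedding with $\dim\mathcal H_{B'}\ge\operatorname{rank}(\rho_{AB})\cdot\dim\mathcal H_A$. -/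

import Mathlib

open scoped Matrix Kronecker MatrixOrder ComplexOrder Topology

noncomputable section

namespace QEntropy

/-! Finite-dimensional Hilbert spaces are `ℂ^X` for a finite index type `X`; operators on them are
square complex matrices, and the tensor product of `ℂ^X` and `ℂ^Y` is `ℂ^(X × Y)`. Entropies are
extended-real numbers, and all logarithms are to base `2`. -/

/-- Sub-normalized states: positive semidefinite operators with `0 < tr ρ ≤ 1`. -/
def IsSubnormState {X : Type*} [Fintype X] (ρ : Matrix X X ℂ) : Prop :=
  ρ.PosSemidef ∧ 0 < ρ.trace.re ∧ ρ.trace.re ≤ 1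

/-- Normalized states: positive semidefinite operators with `tr ρ = 1`. -/
def IsNormState {X : Type*} [Fintype X] (ρ : Matrix X X ℂ) : Prop :=
  ρ.PosSemidef ∧ ρ.trace = 1

/-- Partial trace over the first tensor factor. -/
def traceFst {X Y : Type*} [Fintype X] (M : Matrix (X × Y) (X × Y) ℂ) : Matrix Y Y ℂ :=
  Matrix.of fun i j => ∑ k, M (k, i) (k, j)

/-- Partial trace over the second tensor factor. -/
def traceSnd {X Y : Type*} [Fintype Y] (M : Matrix (X × Y) (X × Y) ℂ) : Matrix X X ℂ :=
  Matrix.of fun i j => ∑ k, M (i, k) (j, k)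

/-- The marginal on `AC` of an operator on `ABC`: the partial trace over `B`. -/
def traceMid {A B C : Type*} [Fintype B] (M : Matrix ((A × B) × C) ((A × B) × C) ℂ) :
    Matrix (A × C) (A × C) ℂ :=
  Matrix.of fun i j => ∑ b, M ((i.1, b), i.2) ((j.1, b), j.2)

/-- The trace norm `tr |X|`, where `|X| = √(X† X)`. -/
def traceAbs {X : Type*} [Fintype X] [DecidableEq X] (M : Matrix X X ℂ) : ℝ :=
  (CFC.sqrt (Mᴴ * M)).trace.re

/-- Generalized fidelity of sub-normalized states. -/
def genFidelity {X : Type*} [Fintype X] [DecidableEq X] (ρ τ : Matrix X X ℂ) : ℝ :=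
  traceAbs (CFC.sqrt ρ * CFC.sqrt τ) + √((1 - ρ.trace.re) * (1 - τ.trace.re))

/-- Purified distance. -/
def purifiedDist {X : Type*} [Fintype X] [DecidableEq X] (ρ τ : Matrix X X ℂ) : ℝ :=
  √(1 - genFidelity ρ τ ^ 2)

/-- The `ε`-ball of sub-normalized states around `ρ` in purified distance. -/
def epsBall {X : Type*} [Fintype X] [DecidableEq X] (ε : ℝ) (ρ : Matrix X X ℂ) :
    Set (Matrix X X ℂ) :=
  {τ | IsSubnormState τ ∧ purifiedDist ρ τ ≤ ε}

/-- Max relative entropy `inf {l : ρ ≤ 2^l τ}`. -/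
def dMax {X : Type*} [Fintype X] (ρ τ : Matrix X X ℂ) : EReal :=
  ⨅ (l : ℝ) (_ : (((2 : ℝ) ^ l) • τ - ρ).PosSemidef), (l : EReal)

/-- Alternative min-entropy of `A` conditioned on `B`: `-Dmax(ρ_AB ‖ 1_A ⊗ ρ_B)`. -/
def altMin {A B : Type*} [Fintype A] [DecidableEq A] [Fintype B]
    (ρ : Matrix (A × B) (A × B) ℂ) : EReal :=
  - dMax ρ ((1 : Matrix A A ℂ) ⊗ₖ traceFst ρ)

/-- Alternative smooth min-entropy of `A` conditioned on `B`: the optimum of `altMin` over the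
`ε`-ball around `ρ`. -/
def altMinSmooth {A B : Type*} [Fintype A] [DecidableEq A] [Fintype B] [DecidableEq B]
    (ε : ℝ) (ρ : Matrix (A × B) (A × B) ℂ) : EReal :=
  sSup (altMin '' epsBall ε ρ)

/-- The (possibly sub-normalized) rank-one operator `|ψ⟩⟨ψ|`. -/
def pureOp {X : Type*} (ψ : X → ℂ) : Matrix X X ℂ := Matrix.vecMulVec ψ (star ψ)

/-- `|ψ⟩⟨ψ|` is a purification of `ρ`, with purifying system `Z`. -/
def IsPurification {X Z : Type*} [Fintype Z] (ψ : X × Z → ℂ) (ρ : Matrix X X ℂ) : Prop :=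
  traceSnd (pureOp ψ) = ρ

/-- A purification of `ρ` with a purifying system of the same dimension: the vector with
coefficients `√ρ i j`. -/
def stdPurification {X : Type*} [Fintype X] [DecidableEq X] (ρ : Matrix X X ℂ) : X × X → ℂ :=
  fun p => CFC.sqrt ρ p.1 p.2

theorem stdPurification_isPurification {X : Type*} [Fintype X] [DecidableEq X]
    {ρ : Matrix X X ℂ} (h : ρ.PosSemidef) : IsPurification (stdPurification ρ) ρ := by
  have hρ : (0 : Matrix X X ℂ) ≤ ρ := Matrix.nonneg_iff_posSemidef.mpr h
  have hs : (CFC.sqrt ρ)ᴴ = CFC.sqrt ρ :=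
    (Matrix.nonneg_iff_posSemidef.mp (CFC.sqrt_nonneg ρ)).isHermitian
  have hm : CFC.sqrt ρ * (CFC.sqrt ρ)ᴴ = ρ := by
    rw [hs]; exact CFC.sqrt_mul_sqrt_self ρ hρ
  unfold IsPurification
  conv_rhs => rw [← hm]
  ext i j
  simp [traceSnd, pureOp, stdPurification, Matrix.vecMulVec_apply, Matrix.mul_apply]

/-- Alternative smooth max-entropy of `A` conditioned on `B`: minus the alternative smooth
min-entropy of `A` conditioned on a system `C` that purifies `ρ_AB`. -/
def altMaxSmooth {A B : Type*} [Fintype A] [DecidableEq A] [Fintype B] [DecidableEq B]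
    (ε : ℝ) (ρ : Matrix (A × B) (A × B) ℂ) : EReal :=
  - altMinSmooth ε (traceMid (pureOp (stdPurification ρ)))

/-- Non-smooth alternative max-entropy: the limit of the smooth one as `ε → 0`. -/
def altMax {A B : Type*} [Fintype A] [DecidableEq A] [Fintype B] [DecidableEq B]
    (ρ : Matrix (A × B) (A × B) ℂ) : EReal :=
  Filter.limUnder (𝓝[>] (0 : ℝ)) fun ε => altMaxSmooth ε ρ

/-- Binary logarithm of a nonnegative number, with `log 0 = -∞`. -/
def log2 (x : ℝ) : EReal := if x ≤ 0 then ⊥ else (Real.logb 2 x : EReal)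

/-- The orthogonal projector onto the support `(ker ρ)ᗮ` of an operator `ρ`. -/
def supportProj {X : Type*} [Fintype X] [DecidableEq X] (ρ : Matrix X X ℂ) : Matrix X X ℂ :=
  (Matrix.toEuclideanCLM (n := X) (𝕜 := ℂ)).symm
    (LinearMap.ker (Matrix.toEuclideanLin ρ))ᗮ.starProjection

/-- `U` is (the matrix of) an isometry `ℂ^B → ℂ^D`. -/
def IsIsometry {B D : Type*} [DecidableEq B] [Fintype D] (U : Matrix D B ℂ) : Prop :=
  Uᴴ * U = 1

/-- `(1_A ⊗ U) ρ_AB (1_A ⊗ U†)`. -/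
def applyOnB {A B D : Type*} [Fintype A] [DecidableEq A] [Fintype B]
    (U : Matrix D B ℂ) (ρ : Matrix (A × B) (A × B) ℂ) : Matrix (A × D) (A × D) ℂ :=
  ((1 : Matrix A A ℂ) ⊗ₖ U) * ρ * ((1 : Matrix A A ℂ) ⊗ₖ Uᴴ)

/-- The optimum (infimum) of the non-smooth alternative max-entropy over the `ε`-ball
around `ρ`. -/
def altMaxBall {A B : Type*} [Fintype A] [DecidableEq A] [Fintype B] [DecidableEq B]
    (ε : ℝ) (ρ : Matrix (A × B) (A × B) ℂ) : EReal :=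
  sInf (altMax '' epsBall ε ρ)

end QEntropy

end

/-!
Tripartite pure states on `A`, `B`, `C` are handled through their coefficient matrices
`T : Matrix (A × B) C ℂ`: the marginal on `AB` is `T * Tᴴ`, and regrouping the indices (`swapBC`)
gives the marginal `compl T` on `AC`. Two matrices with the same Gram matrix differ by a unitary
(`exists_unitary_mul_eq`); this gives polar decompositions, Uhlmann's theorem
(`re_trace_le_traceAbs`, `exists_purification_trace_eq`), and the relation between different
purifications. By Uhlmann's theorem, the `ε`-ball around `R * Rᴴ` is the image under `T ↦ T * Tᴴ`,
away from zero, of the compact set `nearSet ε R` of matrices `T` with large overlap with `R`.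

The alternative min-entropy is upper semicontinuous, because `altMin τ ≥ u` says that
`2 ^ (-u) • (1 ⊗ τ_B) - τ_AB` is positive semidefinite. So its maximum over the ball is attained
when `nearSet ε R` does not contain zero. When it does, the ball contains small multiples of every
state that is not orthogonal to the center (`exists_smul_mem_epsBall`), among them a multiple of the
identity, which maximizes the min-entropy over all states, and a multiple of a maximally entangled
pure state, which minimizes the max-entropy over all states. Semicontinuity also gives the limit
`ε → 0` (`tendsto_altMinSmooth`), hence `altMax (T * Tᴴ) = -altMin (compl T)`.

Compressing with `U†` maps the ball around `U ρ U†` to the ball around `ρ` without decreasing the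
min-entropy, which proves invariance under isometries (`altMinSmooth_applyOnB`). Embedding two
purifying systems into their direct sum then shows that the purification does not matter
(`altMinSmooth_compl_eq`).

For the formula for `altMax`, let `Π` be the support projector. As only the range of the coefficient
matrix matters for `altMin (compl T)`, the pure state may be replaced by the vector with coefficient
matrix `Π`. With `N = swapBC Π`, the condition `N * Nᴴ ≤ t • (1 ⊗ Πᵀ)` is equivalent to
`Nᴴ * N ≤ t`, that is, to `tr_A Π ≤ t` (`gapOp_compl_posSemidef_iff`).

For the smooth duality, Uhlmann's theorem turns a state near `ρ_AB'` into a pure state whose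
marginal on `AC` is near `ρ_AC`. Conversely, with `dim C = rank ρ_AB`, it turns a state near `ρ_AC`
into a pure state with a marginal near `ρ_AB'`, provided that `dim B' ≥ dim A * rank ρ_AB`
(`exists_altMax_eq_altMaxSmooth`).
-/

namespace QEntropy

open Matrix

section

variable {X Y Z : Type*} [Fintype X] [DecidableEq X] [Fintype Y] [DecidableEq Y]
  [Fintype Z] [DecidableEq Z]

/-! ### Matrices with equal Gram matrices -/

/-- The vectors `M *ᵥ v` and `N *ᵥ v` have the same norm, so `N *ᵥ v ↦ M *ᵥ v` is a linear isometry
on the range of `N`, which extends to a unitary. -/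
theorem exists_unitary_mul_eq {M N : Matrix Y X ℂ} (h : Mᴴ * M = Nᴴ * N) :
    ∃ U : Matrix Y Y ℂ, Uᴴ * U = 1 ∧ U * Uᴴ = 1 ∧ M = U * N := by
  set f := toEuclideanLin M with hf
  set g := toEuclideanLin N with hg
  have key : f.adjoint ∘ₗ f = g.adjoint ∘ₗ g := by
    rw [hf, hg, ← toEuclideanLin_conjTranspose_eq_adjoint,
      ← toEuclideanLin_conjTranspose_eq_adjoint]
    ext v : 1
    simp only [LinearMap.comp_apply, toEuclideanLin, toLpLin_apply, mulVec_mulVec, h]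
  have hnorm (v : EuclideanSpace ℂ X) : ‖f v‖ = ‖g v‖ := by
    have e : inner ℂ (f v) (f v) = inner ℂ (g v) (g v) := by
      have hv := LinearMap.congr_fun key v
      rw [LinearMap.comp_apply, LinearMap.comp_apply] at hv
      rw [← LinearMap.adjoint_inner_left, ← LinearMap.adjoint_inner_left, hv]
    rw [@norm_eq_sqrt_re_inner ℂ, @norm_eq_sqrt_re_inner ℂ, e]
  have hker : LinearMap.ker g ≤ LinearMap.ker f := by
    intro v hv
    rw [LinearMap.mem_ker] at hv ⊢
    rw [← norm_eq_zero, hnorm, hv, norm_zero]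
  let L₀ : LinearMap.range g →ₗ[ℂ] EuclideanSpace ℂ Y :=
    (LinearMap.ker g).liftQ f hker ∘ₗ g.quotKerEquivRange.symm.toLinearMap
  have hL₀ (v : EuclideanSpace ℂ X) : L₀ ⟨g v, v, rfl⟩ = f v := by
    have : g.quotKerEquivRange.symm ⟨g v, v, rfl⟩ = (LinearMap.ker g).mkQ v := by
      rw [LinearEquiv.symm_apply_eq]
      ext1
      simp
    simp [L₀, this]
  let L : LinearMap.range g →ₗᵢ[ℂ] EuclideanSpace ℂ Y :=
    { toLinearMap := L₀
      norm_map' := by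
        rintro ⟨_, v, rfl⟩
        rw [hL₀]
        exact hnorm v }
  let u := L.extend
  have hu (v : EuclideanSpace ℂ X) : u (g v) = f v :=
    (L.extend_apply ⟨g v, v, rfl⟩).trans (hL₀ v)
  let U : Matrix Y Y ℂ := toEuclideanLin.symm u.toLinearMap
  have hU : toEuclideanLin U = u.toLinearMap := toEuclideanLin.apply_symm_apply _
  have h1 : Uᴴ * U = 1 := by
    apply toEuclideanLin.injective
    refine LinearMap.ext fun v => ?_
    have : toEuclideanLin (Uᴴ * U) v = (toEuclideanLin U).adjoint (toEuclideanLin U v) := by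
      rw [← toEuclideanLin_conjTranspose_eq_adjoint]
      simp only [toEuclideanLin, toLpLin_apply, mulVec_mulVec]
    rw [this, hU]
    refine ext_inner_right ℂ fun w => ?_
    rw [LinearMap.adjoint_inner_left]
    simp [toEuclideanLin]
  refine ⟨U, h1, mul_eq_one_comm.mp h1, ?_⟩
  apply toEuclideanLin.injective
  refine LinearMap.ext fun v => ?_
  have : toEuclideanLin (U * N) v = toEuclideanLin U (g v) := by
    simp only [hg, toEuclideanLin, toLpLin_apply, mulVec_mulVec]
  rw [this, hU]
  exact (hu v).symm

/-- The isometry `ℂ^X → ℂ^Y` that maps the standard basis vectors along `e : X ↪ Y`. -/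
def embMat (e : X ↪ Y) : Matrix Y X ℂ := of fun y x => if y = e x then 1 else 0

omit [Fintype X] in
theorem embMat_isIsometry (e : X ↪ Y) : IsIsometry (embMat e) := by
  ext i j
  simp [embMat, mul_apply, one_apply, e.injective.eq_iff, eq_comm]

theorem exists_isIsometry (h : Fintype.card X ≤ Fintype.card Y) :
    ∃ W : Matrix Y X ℂ, IsIsometry W := by
  obtain ⟨e⟩ := Function.Embedding.nonempty_of_card_le h
  exact ⟨embMat e, embMat_isIsometry e⟩

theorem sqrt_mul_sqrt {ρ : Matrix X X ℂ} (h : ρ.PosSemidef) : CFC.sqrt ρ * CFC.sqrt ρ = ρ :=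
  CFC.sqrt_mul_sqrt_self ρ (nonneg_iff_posSemidef.mpr h)

theorem sqrt_posSemidef (ρ : Matrix X X ℂ) : (CFC.sqrt ρ).PosSemidef :=
  nonneg_iff_posSemidef.mp (CFC.sqrt_nonneg ρ)

theorem sqrt_conjTranspose (ρ : Matrix X X ℂ) : (CFC.sqrt ρ)ᴴ = CFC.sqrt ρ :=
  (sqrt_posSemidef ρ).isHermitian

omit [DecidableEq X] in
theorem re_trace_pos_of_ne_zero {M : Matrix X X ℂ} (hM : M.PosSemidef) (h : M ≠ 0) :
    0 < M.trace.re := by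
  classical
  have h1 := Complex.nonneg_iff.mp hM.trace_nonneg
  refine lt_of_le_of_ne h1.1 fun hcon => h ?_
  exact hM.trace_eq_zero_iff.mp (Complex.ext hcon.symm h1.2.symm)

theorem sqrt_ne_zero {M : Matrix X X ℂ} (hM : M.PosSemidef) (h : M ≠ 0) : CFC.sqrt M ≠ 0 :=
  fun h0 => h (by rw [← sqrt_mul_sqrt hM, h0, Matrix.zero_mul])

/-- Polar decomposition with a coisometry as its phase. -/
theorem exists_eq_sqrt_mul_coisometry (hc : Fintype.card X ≤ Fintype.card Z) (R : Matrix X Z ℂ) :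
    ∃ W : Matrix X Z ℂ, W * Wᴴ = 1 ∧ R = CFC.sqrt (R * Rᴴ) * W := by
  obtain ⟨E, hE⟩ := exists_isIsometry hc
  unfold IsIsometry at hE
  obtain ⟨U, hU, -, h⟩ := exists_unitary_mul_eq (M := Rᴴ) (N := E * CFC.sqrt (R * Rᴴ)) (by
    rw [conjTranspose_conjTranspose, conjTranspose_mul, sqrt_conjTranspose, Matrix.mul_assoc,
      ← Matrix.mul_assoc Eᴴ, hE, Matrix.one_mul,
      sqrt_mul_sqrt (posSemidef_self_mul_conjTranspose R)])
  refine ⟨Eᴴ * Uᴴ, ?_, ?_⟩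
  · rw [conjTranspose_mul, conjTranspose_conjTranspose, conjTranspose_conjTranspose,
      Matrix.mul_assoc, ← Matrix.mul_assoc Uᴴ, hU, Matrix.one_mul, hE]
  · have := congrArg conjTranspose h
    rw [conjTranspose_conjTranspose, conjTranspose_mul, conjTranspose_mul, sqrt_conjTranspose,
      Matrix.mul_assoc] at this
    exact this

/-- Polar decomposition of a square matrix. -/
theorem exists_eq_unitary_mul_sqrt (M : Matrix X X ℂ) :
    ∃ U : Matrix X X ℂ, Uᴴ * U = 1 ∧ U * Uᴴ = 1 ∧ M = U * CFC.sqrt (Mᴴ * M) := by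
  apply exists_unitary_mul_eq
  rw [sqrt_conjTranspose, sqrt_mul_sqrt (posSemidef_conjTranspose_mul_self M)]

/-! ### Uhlmann's theorem -/

omit [DecidableEq X] [DecidableEq Z] in
theorem re_trace_nonneg (M : Matrix Z X ℂ) : 0 ≤ (Mᴴ * M).trace.re :=
  (Complex.nonneg_iff.mp (posSemidef_conjTranspose_mul_self M).trace_nonneg).1

omit [DecidableEq X] [DecidableEq Z] in
theorem re_trace_conjTranspose_mul_comm (M N : Matrix Z X ℂ) :
    (Nᴴ * M).trace.re = (Mᴴ * N).trace.re := by
  rw [← conjTranspose_conjTranspose M, ← conjTranspose_mul, trace_conjTranspose,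
    conjTranspose_conjTranspose]
  simp

omit [DecidableEq X] [DecidableEq Z] in
theorem re_trace_sub (M N : Matrix Z X ℂ) :
    ((M - N)ᴴ * (M - N)).trace.re =
      (Mᴴ * M).trace.re + (Nᴴ * N).trace.re - 2 * (Mᴴ * N).trace.re := by
  have := re_trace_conjTranspose_mul_comm M N
  simp only [conjTranspose_sub, Matrix.sub_mul, Matrix.mul_sub, trace_sub, Complex.sub_re]
  linarith

omit [DecidableEq X] [DecidableEq Z] in
theorem two_mul_re_trace_le (M N : Matrix Z X ℂ) :
    2 * (Mᴴ * N).trace.re ≤ (Mᴴ * M).trace.re + (Nᴴ * N).trace.re := by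
  have h1 := re_trace_nonneg (M - N)
  rw [re_trace_sub] at h1
  linarith

theorem traceAbs_nonneg (M : Matrix X X ℂ) : 0 ≤ traceAbs M :=
  (Complex.nonneg_iff.mp (sqrt_posSemidef _).trace_nonneg).1

/-- The overlap of two purifications is at most the fidelity, for a purifying system at least as
large as the purified one. -/
theorem re_trace_le_traceAbs_of_card_le (hc : Fintype.card X ≤ Fintype.card Z)
    (R T : Matrix X Z ℂ) :
    (Rᴴ * T).trace.re ≤ traceAbs (CFC.sqrt (R * Rᴴ) * CFC.sqrt (T * Tᴴ)) := by
  obtain ⟨W₀, hW₀, hR⟩ := exists_eq_sqrt_mul_coisometry hc R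
  obtain ⟨W₁, hW₁, hT⟩ := exists_eq_sqrt_mul_coisometry hc T
  set r := CFC.sqrt (R * Rᴴ) with hr
  set t := CFC.sqrt (T * Tᴴ) with ht
  have hrH : rᴴ = r := sqrt_conjTranspose _
  obtain ⟨U, hU, -, hrt⟩ := exists_eq_unitary_mul_sqrt (r * t)
  set P := CFC.sqrt ((r * t)ᴴ * (r * t)) with hP
  set Q := CFC.sqrt P with hQ
  have hQH : Qᴴ = Q := sqrt_conjTranspose _
  have hQQ : Q * Q = P := sqrt_mul_sqrt (sqrt_posSemidef _)
  have e1 : Rᴴ * T = (Q * Uᴴ * W₀)ᴴ * (Q * W₁) := by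
    calc Rᴴ * T = W₀ᴴ * (r * t) * W₁ := by
          conv_lhs => rw [hR, hT]
          simp only [conjTranspose_mul, hrH, Matrix.mul_assoc]
      _ = W₀ᴴ * (U * (Q * Q)) * W₁ := by rw [hrt, hQQ]
      _ = _ := by
          simp only [conjTranspose_mul, conjTranspose_conjTranspose, hQH, Matrix.mul_assoc]
  have e2 : ((Q * Uᴴ * W₀)ᴴ * (Q * Uᴴ * W₀)).trace = P.trace := by
    rw [trace_mul_comm, conjTranspose_mul, Matrix.mul_assoc, ← Matrix.mul_assoc W₀, hW₀,
      Matrix.one_mul, conjTranspose_mul, conjTranspose_conjTranspose, Matrix.mul_assoc,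
      ← Matrix.mul_assoc Uᴴ, hU, Matrix.one_mul, hQH, hQQ]
  have e3 : ((Q * W₁)ᴴ * (Q * W₁)).trace = P.trace := by
    rw [trace_mul_comm, conjTranspose_mul, Matrix.mul_assoc, ← Matrix.mul_assoc W₁, hW₁,
      Matrix.one_mul, hQH, hQQ]
  have := two_mul_re_trace_le (Q * Uᴴ * W₀) (Q * W₁)
  rw [e2, e3, ← e1] at this
  change _ ≤ P.trace.re
  linarith

/-- **Uhlmann's theorem**, upper bound: the overlap of two purifications is at most the
fidelity. -/
theorem re_trace_le_traceAbs (R T : Matrix X Z ℂ) :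
    (Rᴴ * T).trace.re ≤ traceAbs (CFC.sqrt (R * Rᴴ) * CFC.sqrt (T * Tᴴ)) := by
  -- zero columns make the purifying system large enough
  have h := re_trace_le_traceAbs_of_card_le (Z := Z ⊕ X) (by simp)
    (fromCols R (0 : Matrix X X ℂ)) (fromCols T (0 : Matrix X X ℂ))
  rw [conjTranspose_fromCols_eq_fromRows_conjTranspose, fromRows_mul_fromCols,
    trace] at h
  simpa [trace, conjTranspose_fromCols_eq_fromRows_conjTranspose, fromCols_mul_fromRows] using h

/-- **Uhlmann's theorem**, attainment: if the purifying system is large enough, every `τ` has a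
purification whose overlap with the purification `R` is the fidelity. -/
theorem exists_purification_trace_eq (hc : Fintype.card X ≤ Fintype.card Z) (R : Matrix X Z ℂ)
    {τ : Matrix X X ℂ} (hτ : τ.PosSemidef) :
    ∃ T : Matrix X Z ℂ, T * Tᴴ = τ ∧
      (Rᴴ * T).trace.re = traceAbs (CFC.sqrt (R * Rᴴ) * CFC.sqrt τ) := by
  obtain ⟨W, hW, hR⟩ := exists_eq_sqrt_mul_coisometry hc R
  set r := CFC.sqrt (R * Rᴴ) with hr
  set t := CFC.sqrt τ with ht
  have hrH : rᴴ = r := sqrt_conjTranspose _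
  have htH : tᴴ = t := sqrt_conjTranspose _
  obtain ⟨U, hU, hU', hrt⟩ := exists_eq_unitary_mul_sqrt (r * t)
  set P := CFC.sqrt ((r * t)ᴴ * (r * t)) with hP
  refine ⟨t * (Uᴴ * W), ?_, ?_⟩
  · rw [conjTranspose_mul, conjTranspose_mul, conjTranspose_conjTranspose, htH, Matrix.mul_assoc,
      Matrix.mul_assoc Uᴴ, ← Matrix.mul_assoc W, ← Matrix.mul_assoc W, hW, Matrix.one_mul,
      ← Matrix.mul_assoc Uᴴ, hU, Matrix.one_mul, ht, sqrt_mul_sqrt hτ]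
  · have : (Rᴴ * (t * (Uᴴ * W))).trace = P.trace := by
      rw [hR, conjTranspose_mul, hrH, trace_mul_comm, ← Matrix.mul_assoc t, Matrix.mul_assoc,
        ← Matrix.mul_assoc W, hW, Matrix.one_mul, Matrix.mul_assoc, trace_mul_comm,
        Matrix.mul_assoc, hrt, ← Matrix.mul_assoc, hU, Matrix.one_mul]
    rw [this]
    rfl

end

section

variable {X Y Z : Type*} [Fintype X] [DecidableEq X] [Fintype Y] [DecidableEq Y]
  [Fintype Z] [DecidableEq Z]

/-! ### The purified-distance ball in terms of purifications -/

/-- The generalized overlap of the (sub-normalized) pure states with coefficient matrices `R`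
and `T`. By Uhlmann's theorem its maximum over `T` with `T * Tᴴ = τ` is the generalized fidelity
of `R * Rᴴ` and `τ`. -/
noncomputable def overlap (R T : Matrix X Z ℂ) : ℝ :=
  (Rᴴ * T).trace.re + √((1 - (R * Rᴴ).trace.re) * (1 - (T * Tᴴ).trace.re))

/-- Coefficient matrices of pure states with generalized overlap at least `√(1 - ε²)` with `R`.
The zero matrix is allowed, which makes this set compact. -/
def nearSet (ε : ℝ) (R : Matrix X Z ℂ) : Set (Matrix X Z ℂ) :=
  {T | (T * Tᴴ).trace.re ≤ 1 ∧ √(1 - ε ^ 2) ≤ overlap R T}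

theorem genFidelity_nonneg (ρ τ : Matrix X X ℂ) : 0 ≤ genFidelity ρ τ :=
  add_nonneg (traceAbs_nonneg _) (Real.sqrt_nonneg _)

theorem mem_epsBall_iff {ε : ℝ} (hε : 0 ≤ ε) {ρ τ : Matrix X X ℂ} :
    τ ∈ epsBall ε ρ ↔ IsSubnormState τ ∧ √(1 - ε ^ 2) ≤ genFidelity ρ τ := by
  rw [epsBall, Set.mem_ofPred_eq, purifiedDist, Real.sqrt_le_left hε,
    Real.sqrt_le_left (genFidelity_nonneg ρ τ)]
  refine and_congr_right fun _ => ⟨fun h => ?_, fun h => ?_⟩ <;> linarith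

theorem overlap_le_genFidelity (R T : Matrix X Z ℂ) :
    overlap R T ≤ genFidelity (R * Rᴴ) (T * Tᴴ) := by
  have := re_trace_le_traceAbs R T
  unfold overlap genFidelity
  linarith

theorem exists_overlap_eq (hc : Fintype.card X ≤ Fintype.card Z) (R : Matrix X Z ℂ)
    {τ : Matrix X X ℂ} (hτ : τ.PosSemidef) :
    ∃ T : Matrix X Z ℂ, T * Tᴴ = τ ∧ overlap R T = genFidelity (R * Rᴴ) τ := by
  obtain ⟨T, hT, h⟩ := exists_purification_trace_eq hc R hτ
  refine ⟨T, hT, ?_⟩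
  rw [overlap, genFidelity, h, hT]

theorem mul_conjTranspose_mem_epsBall {ε : ℝ} (hε : 0 ≤ ε) {R T : Matrix X Z ℂ}
    (hT : T ∈ nearSet ε R) (h0 : 0 < (T * Tᴴ).trace.re) : T * Tᴴ ∈ epsBall ε (R * Rᴴ) :=
  (mem_epsBall_iff hε).mpr ⟨⟨posSemidef_self_mul_conjTranspose T, h0, hT.1⟩,
    hT.2.trans (overlap_le_genFidelity R T)⟩

theorem exists_mem_nearSet {ε : ℝ} (hε : 0 ≤ ε) (hc : Fintype.card X ≤ Fintype.card Z)
    {R : Matrix X Z ℂ} {τ : Matrix X X ℂ} (hτ : τ ∈ epsBall ε (R * Rᴴ)) :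
    ∃ T ∈ nearSet ε R, T * Tᴴ = τ := by
  obtain ⟨h1, h2⟩ := (mem_epsBall_iff hε).mp hτ
  obtain ⟨T, hT, h⟩ := exists_overlap_eq hc R h1.1
  exact ⟨T, ⟨hT ▸ h1.2.2, h ▸ h2⟩, hT⟩

omit [DecidableEq X] [DecidableEq Z] in
theorem re_trace_eq_sum (T : Matrix X Z ℂ) : (T * Tᴴ).trace.re = ∑ i, ∑ j, ‖T i j‖ ^ 2 := by
  simp [trace, mul_apply, Complex.mul_conj, Complex.normSq_eq_norm_sq, -Complex.ofReal_pow]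

omit [DecidableEq X] [DecidableEq Z] in
theorem eq_zero_of_re_trace_le {T : Matrix X Z ℂ} (h : (T * Tᴴ).trace.re ≤ 0) : T = 0 := by
  have h0 : (T * Tᴴ).trace = 0 := by
    have := Complex.nonneg_iff.mp (posSemidef_self_mul_conjTranspose T).trace_nonneg
    exact Complex.ext (le_antisymm h this.1) this.2.symm
  exact trace_mul_conjTranspose_self_eq_zero_iff.mp h0

omit [DecidableEq X] [DecidableEq Z] in
theorem continuous_re_trace :
    Continuous fun T : Matrix X Z ℂ => (T * Tᴴ).trace.re := by
  fun_prop

omit [DecidableEq X] [DecidableEq Z] in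
theorem continuous_overlap (R : Matrix X Z ℂ) : Continuous (overlap R) := by
  unfold overlap
  fun_prop

omit [DecidableEq X] [DecidableEq Z] in
theorem isCompact_nearSet (ε : ℝ) (R : Matrix X Z ℂ) : IsCompact (nearSet ε R) := by
  have hK : IsCompact {T : Matrix X Z ℂ |
      ∀ i, T i ∈ {v : Z → ℂ | ∀ j, v j ∈ Metric.closedBall 0 1}} :=
    isCompact_pi_infinite fun _ => isCompact_pi_infinite fun _ => isCompact_closedBall _ _
  refine hK.of_isClosed_subset ?_ ?_
  · exact (isClosed_le continuous_re_trace continuous_const).inter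
      (isClosed_le continuous_const (continuous_overlap R))
  · rintro T ⟨hT, -⟩ i j
    rw [mem_closedBall_zero_iff]
    rw [re_trace_eq_sum] at hT
    have h1 : ‖T i j‖ ^ 2 ≤ ∑ j, ‖T i j‖ ^ 2 :=
      Finset.single_le_sum (f := fun j => ‖T i j‖ ^ 2) (fun _ _ => by positivity)
        (Finset.mem_univ j)
    have h2 : ∑ j, ‖T i j‖ ^ 2 ≤ ∑ i, ∑ j, ‖T i j‖ ^ 2 :=
      Finset.single_le_sum (f := fun i => ∑ j, ‖T i j‖ ^ 2) (fun _ _ => by positivity)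
        (Finset.mem_univ i)
    have h3 : ‖T i j‖ ^ 2 ≤ 1 := h1.trans (h2.trans hT)
    nlinarith [norm_nonneg (T i j)]

omit [DecidableEq X] [DecidableEq Z] in
/-- Overlap `1` forces equality, by the equality case of the Cauchy–Schwarz inequality. -/
theorem eq_of_one_le_overlap {R T : Matrix X Z ℂ} (hR : (R * Rᴴ).trace.re ≤ 1)
    (hT : (T * Tᴴ).trace.re ≤ 1) (h : 1 ≤ overlap R T) : T = R := by
  have key := re_trace_sub R T
  rw [trace_mul_comm, trace_mul_comm Rᴴ R, trace_mul_comm Tᴴ T] at key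
  unfold overlap at h
  set a := (R * Rᴴ).trace.re
  set b := (T * Tᴴ).trace.re
  have amgm : √((1 - a) * (1 - b)) ≤ ((1 - a) + (1 - b)) / 2 := by
    rw [Real.sqrt_le_left (by linarith)]
    nlinarith [sq_nonneg (a - b)]
  have : R - T = 0 := eq_zero_of_re_trace_le (by linarith)
  exact (sub_eq_zero.mp this).symm

omit [DecidableEq X] [DecidableEq Z] in
theorem re_trace_pos_of_mem_nearSet {ε : ℝ} {R T : Matrix X Z ℂ} (hR : (R * Rᴴ).trace.re ≤ 1)
    (h : ε ^ 2 < (R * Rᴴ).trace.re) (hT : T ∈ nearSet ε R) : 0 < (T * Tᴴ).trace.re := by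
  by_contra hcon
  have h0 := eq_zero_of_re_trace_le (not_lt.mp hcon)
  have := hT.2
  rw [h0, overlap] at this
  simp only [Matrix.mul_zero, trace_zero, Complex.zero_re, zero_add, Matrix.zero_mul, sub_zero,
    mul_one] at this
  rw [Real.sqrt_le_sqrt_iff (by linarith)] at this
  linarith

/-- If the ball has radius so large that it would contain the zero operator, then it contains
small multiples of every state whose purification `T` has positive overlap with `R`. -/
theorem exists_smul_mem_epsBall {ε : ℝ} (hε : 0 ≤ ε) {R T : Matrix X Z ℂ}
    (hR : (R * Rᴴ).trace.re ≤ 1) (h : (R * Rᴴ).trace.re ≤ ε ^ 2) (hT : 0 < (Rᴴ * T).trace.re) :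
    ∃ s : ℝ, 0 < s ∧ s • (T * Tᴴ) ∈ epsBall ε (R * Rᴴ) := by
  set c := (Rᴴ * T).trace.re with hc
  set d := (T * Tᴴ).trace.re with hd
  set r := (R * Rᴴ).trace.re with hr
  have hd0 : 0 < d := by
    by_contra hcon
    have h0 := eq_zero_of_re_trace_le (not_lt.mp hcon)
    rw [hc, h0] at hT
    simp at hT
  -- the overlap of `s • T` is at least `s * c + √(1 - r) * (1 - s² * d)`, and `s * c ≥ s² * d`
  obtain ⟨s, hs, hs1, hs2⟩ : ∃ s : ℝ, 0 < s ∧ s * d ≤ c ∧ s ^ 2 * d ≤ 1 := by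
    refine ⟨min (c / d) (1 / (1 + d)), by positivity, ?_, ?_⟩
    · calc min (c / d) (1 / (1 + d)) * d ≤ c / d * d := by gcongr; exact min_le_left _ _
        _ = c := by field_simp
    · calc min (c / d) (1 / (1 + d)) ^ 2 * d ≤ (1 / (1 + d)) ^ 2 * d := by
            gcongr; exact min_le_right _ _
        _ = d / (1 + d) ^ 2 := by field_simp
        _ ≤ 1 := by rw [div_le_one (by positivity)]; nlinarith
  have e1 : (s • T) * (s • T)ᴴ = s ^ 2 • (T * Tᴴ) := by
    rw [conjTranspose_smul, star_trivial, Matrix.smul_mul, Matrix.mul_smul, smul_smul, sq]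
  have e2 : ((s • T) * (s • T)ᴴ).trace.re = s ^ 2 * d := by
    rw [e1, trace_smul, Complex.smul_re, smul_eq_mul]
  have e3 : (Rᴴ * (s • T)).trace.re = s * c := by
    rw [Matrix.mul_smul, trace_smul, Complex.smul_re, smul_eq_mul]
  refine ⟨s ^ 2, by positivity, ?_⟩
  rw [← e1]
  refine mul_conjTranspose_mem_epsBall hε ⟨by rw [e2]; exact hs2, ?_⟩ (by rw [e2]; positivity)
  rw [overlap, e2, e3, ← hr, Real.sqrt_mul (by linarith)]
  have h1 : √(1 - ε ^ 2) ≤ √(1 - r) := Real.sqrt_le_sqrt (by linarith)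
  have h2 : √(1 - r) ≤ 1 := by
    rw [Real.sqrt_le_one]
    have := (Complex.nonneg_iff.mp (posSemidef_self_mul_conjTranspose R).trace_nonneg).1
    linarith
  have h3 : 1 - s ^ 2 * d ≤ √(1 - s ^ 2 * d) := by
    apply Real.le_sqrt_of_sq_le
    have : 0 ≤ s ^ 2 * d := by positivity
    nlinarith
  have h4 := mul_le_mul_of_nonneg_left h3 (Real.sqrt_nonneg (1 - r))
  have h5 : s ^ 2 * d ≤ s * c := by nlinarith
  have h6 : √(1 - r) * (s ^ 2 * d) ≤ s ^ 2 * d := mul_le_of_le_one_left (by positivity) h2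
  linarith

end

section

variable {A B D X Z : Type*} [Fintype A] [DecidableEq A] [Fintype B] [DecidableEq B]
  [Fintype D] [DecidableEq D] [Fintype X] [DecidableEq X] [Fintype Z] [DecidableEq Z]

/-! ### The alternative min-entropy as a function of the state -/

omit [DecidableEq X] in
theorem isClosed_posSemidef : IsClosed {M : Matrix X X ℂ | M.PosSemidef} := by
  simp only [posSemidef_iff_dotProduct_mulVec, IsHermitian, Set.ofPred_and, Set.ofPred_forall]
  refine (isClosed_eq (by fun_prop) continuous_id).inter (isClosed_iInter fun v => ?_)
  exact isClosed_le continuous_const (by fun_prop)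

omit [DecidableEq A] [DecidableEq B] [Fintype B] in
theorem traceFst_eq_sum (τ : Matrix (A × B) (A × B) ℂ) :
    traceFst τ = ∑ k, τ.submatrix (Prod.mk k) (Prod.mk k) := by
  ext i j
  simp [traceFst, Matrix.sum_apply]

omit [DecidableEq A] [Fintype B] [DecidableEq B] in
theorem traceFst_posSemidef {τ : Matrix (A × B) (A × B) ℂ} (h : τ.PosSemidef) :
    (traceFst τ).PosSemidef := by
  rw [traceFst_eq_sum]
  exact posSemidef_sum _ fun k _ => h.submatrix _

omit [DecidableEq A] [DecidableEq B] in
theorem trace_traceFst (τ : Matrix (A × B) (A × B) ℂ) : (traceFst τ).trace = τ.trace := by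
  simp only [trace, traceFst, diag_apply, of_apply, Fintype.sum_prod_type]
  exact Finset.sum_comm

omit [DecidableEq B] in
theorem one_kronecker_traceFst_posSemidef {τ : Matrix (A × B) (A × B) ℂ} (h : τ.PosSemidef) :
    ((1 : Matrix A A ℂ) ⊗ₖ traceFst τ).PosSemidef :=
  PosSemidef.one.kronecker (traceFst_posSemidef h)

/-- The operator `t • (1 ⊗ τ_B) - τ_AB`, whose positivity for `t = 2 ^ (-u)` says that the
alternative min-entropy is at least `u`. -/
noncomputable def gapOp (t : ℝ) (τ : Matrix (A × B) (A × B) ℂ) : Matrix (A × B) (A × B) ℂ :=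
  t • ((1 : Matrix A A ℂ) ⊗ₖ traceFst τ) - τ

omit [Fintype B] [DecidableEq B] in
theorem continuous_gapOp (t : ℝ) :
    Continuous (gapOp t : Matrix (A × B) (A × B) ℂ → Matrix (A × B) (A × B) ℂ) := by
  refine continuous_matrix fun i j => ?_
  simp only [gapOp, Matrix.sub_apply, Matrix.smul_apply, kroneckerMap_apply, traceFst, of_apply]
  fun_prop

omit [Fintype B] [DecidableEq B] in
theorem gapOp_smul (t s : ℝ) (τ : Matrix (A × B) (A × B) ℂ) :
    gapOp t (s • τ) = s • gapOp t τ := by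
  have h : traceFst (s • τ) = s • traceFst τ := by
    ext i j
    simp [traceFst, Finset.mul_sum]
  rw [gapOp, gapOp, h, kronecker_smul, smul_sub, smul_comm]

omit [DecidableEq B] in
theorem gapOp_posSemidef_mono {τ : Matrix (A × B) (A × B) ℂ} (h : τ.PosSemidef) {s t : ℝ}
    (hst : s ≤ t) (hs : (gapOp s τ).PosSemidef) : (gapOp t τ).PosSemidef := by
  have : gapOp t τ = gapOp s τ + (t - s) • ((1 : Matrix A A ℂ) ⊗ₖ traceFst τ) := by
    rw [gapOp, gapOp, sub_smul]; abel
  rw [this]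
  exact hs.add ((one_kronecker_traceFst_posSemidef h).smul (sub_nonneg.mpr hst))

omit [DecidableEq B] in
theorem le_altMin {τ : Matrix (A × B) (A × B) ℂ} {u : ℝ}
    (h : (gapOp ((2 : ℝ) ^ (-u)) τ).PosSemidef) : (u : EReal) ≤ altMin τ := by
  rw [altMin, EReal.le_neg, ← EReal.coe_neg]
  exact iInf₂_le (f := fun (l : ℝ) (_ : (gapOp ((2 : ℝ) ^ l) τ).PosSemidef) => (l : EReal)) _ h

omit [DecidableEq B] in
/-- The infimum defining the max relative entropy is attained, since the positive semidefinite
operators form a closed set. -/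
theorem le_altMin_iff {τ : Matrix (A × B) (A × B) ℂ} (hτ : τ.PosSemidef) {u : ℝ} :
    (u : EReal) ≤ altMin τ ↔ (gapOp ((2 : ℝ) ^ (-u)) τ).PosSemidef := by
  refine ⟨fun h => ?_, le_altMin⟩
  rw [altMin, EReal.le_neg, ← EReal.coe_neg] at h
  have hev : ∀ l : ℝ, -u < l → (gapOp ((2 : ℝ) ^ l) τ).PosSemidef := by
    intro l hl
    have h1 : dMax τ ((1 : Matrix A A ℂ) ⊗ₖ traceFst τ) < (l : EReal) :=
      h.trans_lt (EReal.coe_lt_coe_iff.mpr hl)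
    obtain ⟨m, hm⟩ := iInf_lt_iff.mp h1
    obtain ⟨hm1, hm2⟩ := iInf_lt_iff.mp hm
    exact gapOp_posSemidef_mono hτ (Real.rpow_le_rpow_of_exponent_le one_le_two
      (EReal.coe_lt_coe_iff.mp hm2).le) hm1
  have hc : Continuous fun l : ℝ => gapOp ((2 : ℝ) ^ l) τ := by
    unfold gapOp
    have : Continuous fun l : ℝ => (2 : ℝ) ^ l := Real.continuous_const_rpow two_ne_zero
    fun_prop
  have hmem : -u ∈ closure (Set.Ioi (-u)) := by simp
  exact (closure_minimal (s := Set.Ioi (-u)) (t := {l | (gapOp ((2 : ℝ) ^ l) τ).PosSemidef})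
    (fun l hl => hev l hl) (isClosed_posSemidef.preimage hc)) hmem

omit [DecidableEq B] in
theorem upperSemicontinuous_altMin_comp {α : Type*} [TopologicalSpace α]
    {f : α → Matrix (A × B) (A × B) ℂ} (hf : Continuous f) (hp : ∀ a, (f a).PosSemidef) :
    UpperSemicontinuous fun a => altMin (f a) := by
  have hcl (u : ℝ) : IsClosed {a | (u : EReal) ≤ altMin (f a)} := by
    simp only [le_altMin_iff (hp _)]
    exact isClosed_posSemidef.preimage ((continuous_gapOp _).comp hf)
  rw [upperSemicontinuous_iff_isClosed_preimage]
  intro y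
  induction y with
  | bot => simp
  | coe u => exact hcl u
  | top =>
    have : (fun a => altMin (f a)) ⁻¹' Set.Ici ⊤ = ⋂ u : ℝ, {a | (u : EReal) ≤ altMin (f a)} := by
      ext a
      simp only [Set.mem_preimage, Set.mem_Ici, top_le_iff, Set.mem_iInter, Set.mem_ofPred_eq]
      refine ⟨fun h u => h ▸ le_top, fun h => EReal.eq_top_iff_forall_lt _ |>.mpr fun u => ?_⟩
      exact lt_of_lt_of_le (EReal.coe_lt_coe_iff.mpr (lt_add_one u)) (h (u + 1))
    rw [this]
    exact isClosed_iInter hcl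

omit [DecidableEq B] in
theorem altMin_le_of_forall {ρ : Matrix (A × B) (A × B) ℂ} {x : EReal}
    (h : ∀ l : ℝ, (gapOp ((2 : ℝ) ^ l) ρ).PosSemidef → -x ≤ l) : altMin ρ ≤ x := by
  rw [altMin, EReal.neg_le]
  exact le_iInf₂ h

omit [DecidableEq B] in
theorem altMin_mono {A' B' : Type*} [Fintype A'] [DecidableEq A'] [Fintype B']
    {ρ : Matrix (A × B) (A × B) ℂ} {τ : Matrix (A' × B') (A' × B') ℂ}
    (h : ∀ t : ℝ, 0 < t → (gapOp t ρ).PosSemidef → (gapOp t τ).PosSemidef) :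
    altMin ρ ≤ altMin τ := by
  rw [altMin, altMin, EReal.neg_le_neg_iff]
  exact le_iInf₂ fun l hl => iInf₂_le l (h _ (by positivity) hl)

omit [DecidableEq B] in
theorem altMin_smul {s : ℝ} (hs : 0 < s) (τ : Matrix (A × B) (A × B) ℂ) :
    altMin (s • τ) = altMin τ := by
  refine le_antisymm (altMin_mono fun t _ h => ?_) (altMin_mono fun t _ h => ?_)
  · rw [gapOp_smul] at h
    have := h.smul (inv_nonneg.mpr hs.le)
    rwa [smul_smul, inv_mul_cancel₀ hs.ne', one_smul] at this
  · rw [gapOp_smul]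
    exact h.smul hs.le

omit [DecidableEq B] in
theorem re_trace_gapOp (t : ℝ) (τ : Matrix (A × B) (A × B) ℂ) :
    (gapOp t τ).trace.re = (t * Fintype.card A - 1) * τ.trace.re := by
  rw [gapOp, trace_sub, trace_smul, trace_kronecker, trace_traceFst, trace_one]
  simp
  ring

omit [DecidableEq B] in
theorem altMin_le_logb_card {τ : Matrix (A × B) (A × B) ℂ} (hτ : 0 < τ.trace.re) :
    altMin τ ≤ (Real.logb 2 (Fintype.card A) : EReal) := by
  refine altMin_le_of_forall fun l hl => ?_
  have h1 := (Complex.nonneg_iff.mp hl.trace_nonneg).1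
  rw [re_trace_gapOp] at h1
  have h2 : 1 ≤ (2 : ℝ) ^ l * Fintype.card A := by
    have := nonneg_of_mul_nonneg_left h1 hτ
    linarith
  have h0 : (0 : ℝ) < Fintype.card A := by
    by_contra hcon
    have : (Fintype.card A : ℝ) = 0 := le_antisymm (not_lt.mp hcon) (by positivity)
    rw [this] at h2
    norm_num at h2
  rw [← EReal.coe_neg, EReal.coe_le_coe_iff, ← Real.logb_inv,
    Real.logb_le_iff_le_rpow one_lt_two (by positivity)]
  rw [inv_le_iff_one_le_mul₀ h0]
  exact h2

theorem logb_card_le_altMin_one [Nonempty A] :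
    (Real.logb 2 (Fintype.card A) : EReal) ≤ altMin (1 : Matrix (A × B) (A × B) ℂ) := by
  apply le_altMin
  have h0 : (0 : ℝ) < Fintype.card A := by exact_mod_cast Fintype.card_pos
  rw [Real.rpow_neg zero_le_two, Real.rpow_logb two_pos (by norm_num) h0]
  have : gapOp ((Fintype.card A : ℝ)⁻¹) (1 : Matrix (A × B) (A × B) ℂ) = 0 := by
    ext ⟨a, b⟩ ⟨a', b'⟩
    have h0' : (Fintype.card A : ℂ) ≠ 0 := by exact_mod_cast h0.ne'
    simp only [gapOp, traceFst, Matrix.sub_apply, Matrix.smul_apply, kronecker_apply, of_apply,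
      one_apply, Matrix.zero_apply, Prod.mk.injEq]
    by_cases h1 : a = a' <;> by_cases h2 : b = b' <;> simp [h1, h2, h0']
  rw [this]
  exact PosSemidef.zero

/-! ### The smooth alternative min-entropy -/

omit [DecidableEq X] in
theorem IsSubnormState.nonempty {ρ : Matrix X X ℂ} (h : IsSubnormState ρ) : Nonempty X := by
  by_contra hcon
  rw [not_nonempty_iff] at hcon
  have := h.2.1
  simp [trace] at this

theorem exists_mul_conjTranspose_eq (hc : Fintype.card X ≤ Fintype.card Z) {ρ : Matrix X X ℂ}
    (h : ρ.PosSemidef) : ∃ R : Matrix X Z ℂ, R * Rᴴ = ρ := by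
  obtain ⟨R, hR, -⟩ := exists_purification_trace_eq hc 0 h
  exact ⟨R, hR⟩

omit [DecidableEq X] [DecidableEq Z] in
theorem self_mem_nearSet {ε : ℝ} {R : Matrix X Z ℂ} (hR : (R * Rᴴ).trace.re ≤ 1) :
    R ∈ nearSet ε R := by
  refine ⟨hR, ?_⟩
  have h1 : √(1 - ε ^ 2) ≤ 1 := Real.sqrt_le_one.mpr (by nlinarith [sq_nonneg ε])
  rw [overlap, Real.sqrt_mul_self (by linarith), trace_mul_comm]
  linarith

/-- A large ball contains a multiple of the identity, for which the alternative min-entropy is as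
large as it can be. -/
theorem exists_mem_epsBall_logb_le {ε : ℝ} (hε : 0 ≤ ε) {ρ : Matrix (A × B) (A × B) ℂ}
    (hρ : IsSubnormState ρ) (h : ρ.trace.re ≤ ε ^ 2) :
    ∃ τ ∈ epsBall ε ρ, (Real.logb 2 (Fintype.card A) : EReal) ≤ altMin τ := by
  have hA : Nonempty A := hρ.nonempty.map Prod.fst
  set r := CFC.sqrt ρ with hr
  have hrH : rᴴ = r := sqrt_conjTranspose ρ
  have hrr : r * rᴴ = ρ := by rw [hrH]; exact sqrt_mul_sqrt hρ.1
  have h0 : 0 < (rᴴ * (1 : Matrix (A × B) (A × B) ℂ)).trace.re := by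
    rw [hrH, Matrix.mul_one]
    refine re_trace_pos_of_ne_zero (sqrt_posSemidef ρ) (sqrt_ne_zero hρ.1 ?_)
    rintro rfl
    simpa using hρ.2.1
  obtain ⟨s, hs, hmem⟩ := exists_smul_mem_epsBall hε (R := r) (T := 1) (by rw [hrr]; exact hρ.2.2)
    (by rw [hrr]; exact h) h0
  rw [hrr, conjTranspose_one, Matrix.mul_one] at hmem
  refine ⟨_, hmem, ?_⟩
  rw [altMin_smul hs]
  exact logb_card_le_altMin_one

theorem exists_forall_altMin_le {ε : ℝ} (hε : 0 ≤ ε) {ρ : Matrix (A × B) (A × B) ℂ}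
    (hρ : IsSubnormState ρ) : ∃ τ ∈ epsBall ε ρ, ∀ τ' ∈ epsBall ε ρ, altMin τ' ≤ altMin τ := by
  by_cases h : ρ.trace.re ≤ ε ^ 2
  · obtain ⟨τ, hτ, hl⟩ := exists_mem_epsBall_logb_le hε hρ h
    exact ⟨τ, hτ, fun τ' hτ' => (altMin_le_logb_card hτ'.1.2.1).trans hl⟩
  · obtain ⟨R, rfl⟩ := exists_mul_conjTranspose_eq (Z := A × B) le_rfl hρ.1
    obtain ⟨T, hT, hmax⟩ := UpperSemicontinuousOn.exists_isMaxOn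
      (f := fun T : Matrix (A × B) (A × B) ℂ => altMin (T * Tᴴ))
      ⟨R, self_mem_nearSet (ε := ε) hρ.2.2⟩ (isCompact_nearSet ε R)
      ((upperSemicontinuous_altMin_comp
        (continuous_id.matrix_mul continuous_id.matrix_conjTranspose)
        fun T => posSemidef_self_mul_conjTranspose T).upperSemicontinuousOn _)
    refine ⟨_, mul_conjTranspose_mem_epsBall hε hT
      (re_trace_pos_of_mem_nearSet hρ.2.2 (not_le.mp h) hT), fun τ' hτ' => ?_⟩
    obtain ⟨T', hT', rfl⟩ := exists_mem_nearSet hε le_rfl hτ'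
    exact hmax hT'

theorem isGreatest_altMinSmooth {ε : ℝ} (hε : 0 ≤ ε) {ρ : Matrix (A × B) (A × B) ℂ}
    (hρ : IsSubnormState ρ) : IsGreatest (altMin '' epsBall ε ρ) (altMinSmooth ε ρ) := by
  obtain ⟨τ, hτ, hmax⟩ := exists_forall_altMin_le hε hρ
  have h : IsGreatest (altMin '' epsBall ε ρ) (altMin τ) :=
    ⟨⟨τ, hτ, rfl⟩, by rintro _ ⟨τ', hτ', rfl⟩; exact hmax τ' hτ'⟩
  rwa [altMinSmooth, h.isLUB.sSup_eq]

/-! ### Invariance under isometries on the second system -/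

omit [DecidableEq B] [Fintype D] [DecidableEq D] in
theorem applyOnB_mul_conjTranspose {C : Type*} [Fintype C] (U : Matrix D B ℂ)
    (R : Matrix (A × B) C ℂ) :
    applyOnB U (R * Rᴴ) =
      (((1 : Matrix A A ℂ) ⊗ₖ U) * R) * (((1 : Matrix A A ℂ) ⊗ₖ U) * R)ᴴ := by
  rw [applyOnB, conjTranspose_mul, conjTranspose_kronecker, conjTranspose_one]
  simp only [Matrix.mul_assoc]

omit [DecidableEq B] [DecidableEq D] [Fintype D] in
theorem traceFst_applyOnB (U : Matrix D B ℂ) (ρ : Matrix (A × B) (A × B) ℂ) :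
    traceFst (applyOnB U ρ) = U * traceFst ρ * Uᴴ := by
  ext i j
  simp only [traceFst, applyOnB, of_apply, mul_apply, kronecker_apply, one_apply,
    Fintype.sum_prod_type, ite_mul, one_mul, zero_mul, mul_ite, mul_zero, Finset.sum_ite_irrel,
    Finset.sum_const_zero, Finset.sum_ite_eq, Finset.sum_ite_eq', Finset.mem_univ, if_true,
    Finset.sum_mul, Finset.mul_sum]
  rw [Finset.sum_comm]
  refine Finset.sum_congr rfl fun b _ => ?_
  rw [Finset.sum_comm]

omit [DecidableEq B] [DecidableEq D] [Fintype D] in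
theorem gapOp_applyOnB (t : ℝ) (U : Matrix D B ℂ) (ρ : Matrix (A × B) (A × B) ℂ) :
    gapOp t (applyOnB U ρ) = applyOnB U (gapOp t ρ) := by
  rw [gapOp, traceFst_applyOnB]
  simp only [applyOnB, gapOp, Matrix.mul_sub, Matrix.sub_mul, Matrix.mul_smul, Matrix.smul_mul,
    ← mul_kronecker_mul, Matrix.one_mul]

omit [DecidableEq B] [DecidableEq D] in
theorem applyOnB_posSemidef (U : Matrix D B ℂ) {ρ : Matrix (A × B) (A × B) ℂ}
    (h : ρ.PosSemidef) : (applyOnB U ρ).PosSemidef := by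
  have := h.mul_mul_conjTranspose_same ((1 : Matrix A A ℂ) ⊗ₖ U)
  rwa [conjTranspose_kronecker, conjTranspose_one] at this

omit [DecidableEq B] [DecidableEq D] in
theorem altMin_le_altMin_applyOnB (U : Matrix D B ℂ) (ρ : Matrix (A × B) (A × B) ℂ) :
    altMin ρ ≤ altMin (applyOnB U ρ) :=
  altMin_mono fun t _ h => by
    rw [gapOp_applyOnB]
    exact applyOnB_posSemidef U h

omit [Fintype B] [DecidableEq D] in
theorem IsIsometry.one_kronecker {U : Matrix D B ℂ} (hU : IsIsometry U) :
    ((1 : Matrix A A ℂ) ⊗ₖ U)ᴴ * ((1 : Matrix A A ℂ) ⊗ₖ U) = 1 := by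
  rw [conjTranspose_kronecker, ← mul_kronecker_mul, hU, conjTranspose_one, Matrix.one_mul,
    one_kronecker_one]

omit [DecidableEq D] in
theorem trace_applyOnB {U : Matrix D B ℂ} (hU : IsIsometry U) (ρ : Matrix (A × B) (A × B) ℂ) :
    (applyOnB U ρ).trace = ρ.trace := by
  have := hU.one_kronecker (A := A)
  rw [conjTranspose_kronecker, conjTranspose_one] at this
  rw [applyOnB, trace_mul_comm, ← Matrix.mul_assoc, this, Matrix.one_mul]

omit [DecidableEq D] in
theorem IsSubnormState.applyOnB {U : Matrix D B ℂ} (hU : IsIsometry U)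
    {ρ : Matrix (A × B) (A × B) ℂ} (h : IsSubnormState ρ) : IsSubnormState (applyOnB U ρ) := by
  refine ⟨applyOnB_posSemidef U h.1, ?_⟩
  rw [trace_applyOnB hU]
  exact h.2

theorem applyOnB_mem_epsBall {ε : ℝ} (hε : 0 ≤ ε) {U : Matrix D B ℂ} (hU : IsIsometry U)
    {ρ τ : Matrix (A × B) (A × B) ℂ} (hρ : IsSubnormState ρ) (hτ : τ ∈ epsBall ε ρ) :
    applyOnB U τ ∈ epsBall ε (applyOnB U ρ) := by
  obtain ⟨R, rfl⟩ := exists_mul_conjTranspose_eq (Z := A × B) le_rfl hρ.1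
  obtain ⟨T, hT, rfl⟩ := exists_mem_nearSet hε le_rfl hτ
  have h0 := (hτ.1.applyOnB hU).2.1
  have e1 := trace_applyOnB hU (R * Rᴴ)
  have e2 := trace_applyOnB hU (T * Tᴴ)
  rw [applyOnB_mul_conjTranspose] at h0 e1 e2
  rw [applyOnB_mul_conjTranspose, applyOnB_mul_conjTranspose]
  refine mul_conjTranspose_mem_epsBall hε ⟨?_, ?_⟩ h0
  · rw [e2]
    exact hT.1
  · rw [overlap, e1, e2, conjTranspose_mul, Matrix.mul_assoc, ← Matrix.mul_assoc (_ ⊗ₖ _)ᴴ,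
      hU.one_kronecker, Matrix.one_mul]
    exact hT.2

/-- A state in the ball around `U ρ U†` is compressed by `U†` to a state in the ball around `ρ`,
which does not decrease the min-entropy. If the compression is zero, the ball is large. -/
theorem exists_mem_epsBall_of_applyOnB {ε : ℝ} (hε : 0 ≤ ε) {U : Matrix D B ℂ}
    (hU : IsIsometry U) {ρ : Matrix (A × B) (A × B) ℂ} (hρ : IsSubnormState ρ)
    {τ : Matrix (A × D) (A × D) ℂ} (hτ : τ ∈ epsBall ε (applyOnB U ρ)) :
    ∃ τ' ∈ epsBall ε ρ, altMin τ ≤ altMin τ' := by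
  obtain ⟨R, rfl⟩ := exists_mul_conjTranspose_eq (Z := (A × B) ⊕ (A × D))
    (by simp [Fintype.card_sum]) hρ.1
  have e1 := trace_applyOnB hU (R * Rᴴ)
  rw [applyOnB_mul_conjTranspose] at hτ e1
  obtain ⟨T, hT, rfl⟩ := exists_mem_nearSet hε (by simp [Fintype.card_sum]) hτ
  set T' := ((1 : Matrix A A ℂ) ⊗ₖ Uᴴ) * T with hT'
  have htr : (T' * T'ᴴ).trace.re ≤ (T * Tᴴ).trace.re := by
    -- the difference is the squared Hilbert–Schmidt norm of `(1 - 1 ⊗ UU†) T`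
    set V := (1 : Matrix A A ℂ) ⊗ₖ U with hV
    have hVV : Vᴴ * V = 1 := hU.one_kronecker
    have hT'' : T' = Vᴴ * T := by rw [hT', hV, conjTranspose_kronecker, conjTranspose_one]
    have h1 := re_trace_nonneg (T - V * (Vᴴ * T))
    have h2 : (V * (Vᴴ * T))ᴴ * (V * (Vᴴ * T)) = (Vᴴ * T)ᴴ * (Vᴴ * T) := by
      rw [conjTranspose_mul V, Matrix.mul_assoc, ← Matrix.mul_assoc Vᴴ V, hVV, Matrix.one_mul]
    have h3 : Tᴴ * (V * (Vᴴ * T)) = (Vᴴ * T)ᴴ * (Vᴴ * T) := by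
      rw [conjTranspose_mul, conjTranspose_conjTranspose, Matrix.mul_assoc]
    rw [re_trace_sub, h2, h3] at h1
    rw [trace_mul_comm, trace_mul_comm T, hT'']
    linarith
  have hin : (((1 : Matrix A A ℂ) ⊗ₖ U) * R)ᴴ * T = Rᴴ * T' := by
    rw [conjTranspose_mul, conjTranspose_kronecker, conjTranspose_one, Matrix.mul_assoc]
  have hmem : T' ∈ nearSet ε R := by
    refine ⟨htr.trans hT.1, hT.2.trans ?_⟩
    rw [overlap, overlap, hin, e1]
    gcongr
    linarith [hρ.2.2]
  by_cases h0 : 0 < (T' * T'ᴴ).trace.re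
  · refine ⟨_, mul_conjTranspose_mem_epsBall hε hmem h0, ?_⟩
    have := altMin_le_altMin_applyOnB Uᴴ (T * Tᴴ)
    rwa [applyOnB_mul_conjTranspose] at this
  · obtain ⟨τ', hτ', hl⟩ := exists_mem_epsBall_logb_le hε hρ (by
      by_contra hcon
      exact h0 (re_trace_pos_of_mem_nearSet hρ.2.2 (not_le.mp hcon) hmem))
    exact ⟨τ', hτ', (altMin_le_logb_card hτ.1.2.1).trans hl⟩

theorem altMinSmooth_applyOnB {ε : ℝ} (hε : 0 ≤ ε) {U : Matrix D B ℂ} (hU : IsIsometry U)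
    {ρ : Matrix (A × B) (A × B) ℂ} (hρ : IsSubnormState ρ) :
    altMinSmooth ε (applyOnB U ρ) = altMinSmooth ε ρ := by
  apply le_antisymm
  · refine sSup_le ?_
    rintro _ ⟨τ, hτ, rfl⟩
    obtain ⟨τ', hτ', h⟩ := exists_mem_epsBall_of_applyOnB hε hU hρ hτ
    exact h.trans (le_sSup ⟨τ', hτ', rfl⟩)
  · refine sSup_le ?_
    rintro _ ⟨τ, hτ, rfl⟩
    exact (altMin_le_altMin_applyOnB U τ).trans
      (le_sSup ⟨_, applyOnB_mem_epsBall hε hU hρ hτ, rfl⟩)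

end

section

variable {A B C C' D : Type*} [Fintype A] [DecidableEq A] [Fintype B] [DecidableEq B]
  [Fintype C] [DecidableEq C] [Fintype C'] [DecidableEq C'] [Fintype D] [DecidableEq D]

/-! ### The two marginals of a tripartite pure state -/

/-- If `T` is the coefficient matrix of a tripartite vector with respect to the bipartition
`AB : C`, this is its coefficient matrix with respect to `AC : B`. Thus `T * Tᴴ` is the marginal on
`AB` and `swapBC T * (swapBC T)ᴴ` is the marginal on `AC`. -/
def swapBC {A B C : Type*} (T : Matrix (A × B) C ℂ) : Matrix (A × C) B ℂ :=
  of fun p b => T (p.1, b) p.2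

omit [Fintype A] [DecidableEq A] [Fintype B] [DecidableEq B] [Fintype C] [DecidableEq C] in
theorem swapBC_swapBC (T : Matrix (A × B) C ℂ) : swapBC (swapBC T) = T := rfl

/-- The marginal on `AC` of the tripartite pure state with coefficient matrix `T`. -/
noncomputable def compl {A B C : Type*} [Fintype B] (T : Matrix (A × B) C ℂ) :
    Matrix (A × C) (A × C) ℂ :=
  swapBC T * (swapBC T)ᴴ

omit [Fintype A] [DecidableEq A] [Fintype B] [DecidableEq B] [DecidableEq C] in
theorem traceSnd_pureOp (ψ : (A × B) × C → ℂ) :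
    traceSnd (pureOp ψ) = of (fun x z => ψ (x, z)) * (of fun x z => ψ (x, z))ᴴ := by
  ext i j
  simp [traceSnd, pureOp, vecMulVec_apply, mul_apply]

omit [Fintype A] [DecidableEq A] [DecidableEq B] [Fintype C] [DecidableEq C] in
theorem traceMid_pureOp (ψ : (A × B) × C → ℂ) :
    traceMid (pureOp ψ) = compl (of fun x z => ψ (x, z)) := by
  ext i j
  simp [traceMid, pureOp, vecMulVec_apply, mul_apply, compl, swapBC]

omit [DecidableEq A] [DecidableEq B] [DecidableEq C] in
theorem trace_swapBC (R T : Matrix (A × B) C ℂ) :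
    ((swapBC R)ᴴ * swapBC T).trace = (Rᴴ * T).trace := by
  simp only [trace, diag_apply, mul_apply, conjTranspose_apply, swapBC, of_apply,
    Fintype.sum_prod_type]
  rw [Finset.sum_comm]
  conv_rhs => rw [Finset.sum_comm]
  refine Finset.sum_congr rfl fun a _ => ?_
  rw [Finset.sum_comm]

omit [DecidableEq A] [DecidableEq B] [DecidableEq C] in
theorem trace_compl (T : Matrix (A × B) C ℂ) : (compl T).trace = (T * Tᴴ).trace := by
  rw [compl, trace_mul_comm, trace_swapBC, trace_mul_comm]

omit [DecidableEq A] [DecidableEq B] [DecidableEq C] in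
theorem overlap_swapBC (R T : Matrix (A × B) C ℂ) :
    overlap (swapBC R) (swapBC T) = overlap R T := by
  have h1 := trace_compl R
  have h2 := trace_compl T
  rw [compl] at h1 h2
  rw [overlap, overlap, trace_swapBC, h1, h2]

omit [DecidableEq A] [DecidableEq B] [DecidableEq C] in
theorem swapBC_mem_nearSet {ε : ℝ} {R T : Matrix (A × B) C ℂ} (h : T ∈ nearSet ε R) :
    swapBC T ∈ nearSet ε (swapBC R) := by
  refine ⟨?_, by rw [overlap_swapBC]; exact h.2⟩
  have := trace_compl T
  rw [compl] at this
  rw [this]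
  exact h.1

omit [DecidableEq A] [DecidableEq B] [DecidableEq C] in
theorem isSubnormState_compl {T : Matrix (A × B) C ℂ} (h : IsSubnormState (T * Tᴴ)) :
    IsSubnormState (compl T) :=
  ⟨posSemidef_self_mul_conjTranspose _, by rw [trace_compl]; exact h.2⟩

/-- Tripartite pure states with large overlap have nearby marginals on `AC`. -/
theorem compl_mem_epsBall {ε : ℝ} (hε : 0 ≤ ε) {R T : Matrix (A × B) C ℂ}
    (hT : T ∈ nearSet ε R) (h : 0 < (T * Tᴴ).trace.re) : compl T ∈ epsBall ε (compl R) :=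
  mul_conjTranspose_mem_epsBall hε (swapBC_mem_nearSet hT) (by
    have := trace_compl T
    rw [compl] at this
    rwa [this])

omit [DecidableEq B] [Fintype B] [DecidableEq C] [Fintype D] [DecidableEq D] in
theorem swapBC_mul_transpose (T : Matrix (A × B) C ℂ) (W : Matrix D C ℂ) :
    swapBC (T * Wᵀ) = ((1 : Matrix A A ℂ) ⊗ₖ W) * swapBC T := by
  ext ⟨a, d⟩ b
  simp [swapBC, mul_apply, Fintype.sum_prod_type, one_apply, mul_comm]

omit [DecidableEq B] [DecidableEq C] [Fintype D] [DecidableEq D] in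
theorem compl_mul_transpose (T : Matrix (A × B) C ℂ) (W : Matrix D C ℂ) :
    compl (T * Wᵀ) = applyOnB W (compl T) := by
  rw [compl, swapBC_mul_transpose, compl, applyOnB_mul_conjTranspose]

omit [Fintype B] [DecidableEq D] in
theorem IsIsometry.transpose_mul {V : Matrix D B ℂ}
    (hV : IsIsometry V) : Vᵀ * (Vᵀ)ᴴ = 1 := by
  have := congrArg transpose hV
  rwa [Matrix.transpose_mul, transpose_one] at this

omit [Fintype C] [DecidableEq C] [DecidableEq D] in
/-- An isometry on `B` does not change the marginal on `AC`. -/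
theorem compl_one_kronecker_mul {V : Matrix D B ℂ} (hV : IsIsometry V)
    (T : Matrix (A × B) C ℂ) : compl (((1 : Matrix A A ℂ) ⊗ₖ V) * T) = compl T := by
  have h1 : swapBC (((1 : Matrix A A ℂ) ⊗ₖ V) * T) = swapBC T * Vᵀ := by
    have := congrArg swapBC (swapBC_mul_transpose (swapBC T) V)
    exact this.symm
  rw [compl, compl, h1, conjTranspose_mul, Matrix.mul_assoc, ← Matrix.mul_assoc Vᵀ,
    hV.transpose_mul, Matrix.one_mul]

/-! ### Independence of the purification -/

/-- Both purifying systems embed into their direct sum, where the two purifications differ by a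
unitary. -/
theorem altMinSmooth_compl_eq {ε : ℝ} (hε : 0 ≤ ε) {T : Matrix (A × B) C ℂ}
    {T' : Matrix (A × B) C' ℂ} (h : IsSubnormState (T * Tᴴ)) (hTT : T * Tᴴ = T' * T'ᴴ) :
    altMinSmooth ε (compl T) = altMinSmooth ε (compl T') := by
  obtain ⟨E, hE⟩ := exists_isIsometry (X := C) (Y := C ⊕ C') (by simp)
  obtain ⟨E', hE'⟩ := exists_isIsometry (X := C') (Y := C ⊕ C') (by simp)
  obtain ⟨U, hU, -, hUeq⟩ := exists_unitary_mul_eq (M := (T * Eᵀ)ᴴ) (N := (T' * E'ᵀ)ᴴ) (by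
    rw [conjTranspose_conjTranspose, conjTranspose_conjTranspose, conjTranspose_mul,
      conjTranspose_mul, Matrix.mul_assoc, ← Matrix.mul_assoc Eᵀ, hE.transpose_mul, Matrix.one_mul,
      Matrix.mul_assoc, ← Matrix.mul_assoc E'ᵀ, hE'.transpose_mul, Matrix.one_mul, hTT])
  have hW : IsIsometry (Uᴴ)ᵀ := by
    have : Uᴴᴴᵀ * Uᴴᵀ = 1 := by
      rw [← transpose_mul, conjTranspose_conjTranspose, hU, transpose_one]
    exact this
  have e : T * Eᵀ = T' * E'ᵀ * ((Uᴴ)ᵀ)ᵀ := by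
    have := congrArg conjTranspose hUeq
    rwa [conjTranspose_conjTranspose, conjTranspose_mul U, conjTranspose_conjTranspose] at this
  have e2 := congrArg compl e
  rw [compl_mul_transpose, compl_mul_transpose, compl_mul_transpose] at e2
  have h' : IsSubnormState (compl T') := isSubnormState_compl (hTT ▸ h)
  rw [← altMinSmooth_applyOnB hε hE (isSubnormState_compl h), e2,
    altMinSmooth_applyOnB hε hW (h'.applyOnB hE'), altMinSmooth_applyOnB hε hE' h']

theorem altMaxSmooth_mul_conjTranspose {ε : ℝ} (hε : 0 ≤ ε) {T : Matrix (A × B) C ℂ}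
    (h : IsSubnormState (T * Tᴴ)) : altMaxSmooth ε (T * Tᴴ) = -altMinSmooth ε (compl T) := by
  have hp := stdPurification_isPurification h.1
  rw [IsPurification, traceSnd_pureOp] at hp
  rw [altMaxSmooth, traceMid_pureOp, altMinSmooth_compl_eq hε (by rw [hp]; exact h) hp]

/-! ### The limit of vanishing smoothing -/

theorem self_mem_epsBall {ε : ℝ} (hε : 0 ≤ ε) {ρ : Matrix (A × B) (A × B) ℂ}
    (hρ : IsSubnormState ρ) : ρ ∈ epsBall ε ρ := by
  obtain ⟨R, rfl⟩ := exists_mul_conjTranspose_eq (Z := A × B) le_rfl hρ.1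
  exact mul_conjTranspose_mem_epsBall hε (self_mem_nearSet hρ.2.2) hρ.2.1

/-- The states in a small ball with min-entropy at least `a > altMin ρ` form a compact family
that misses `ρ`, so their overlap with `ρ` is bounded away from `1`. -/
theorem tendsto_altMinSmooth {ρ : Matrix (A × B) (A × B) ℂ} (hρ : IsSubnormState ρ) :
    Filter.Tendsto (fun ε : ℝ => altMinSmooth ε ρ) (𝓝[>] 0) (𝓝 (altMin ρ)) := by
  refine tendsto_order.mpr ⟨fun a ha => ?_, fun a ha => ?_⟩
  · filter_upwards [self_mem_nhdsWithin] with ε hε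
    exact ha.trans_le (le_sSup ⟨ρ, self_mem_epsBall (le_of_lt hε) hρ, rfl⟩)
  · obtain ⟨R, rfl⟩ := exists_mul_conjTranspose_eq (Z := A × B) le_rfl hρ.1
    have husc : UpperSemicontinuous fun T : Matrix (A × B) (A × B) ℂ => altMin (T * Tᴴ) :=
      upperSemicontinuous_altMin_comp (continuous_id.matrix_mul continuous_id.matrix_conjTranspose)
        fun T => posSemidef_self_mul_conjTranspose T
    set K := nearSet 1 R ∩ {T : Matrix (A × B) (A × B) ℂ | a ≤ altMin (T * Tᴴ)} with hK
    have hKc : IsCompact K := (isCompact_nearSet 1 R).inter_right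
      (upperSemicontinuous_iff_isClosed_preimage.mp husc a)
    obtain ⟨m, hm, hKm⟩ : ∃ m < 1, ∀ T ∈ K, overlap R T ≤ m := by
      rcases K.eq_empty_or_nonempty with h0 | h0
      · exact ⟨0, one_pos, by simp [h0]⟩
      · obtain ⟨T, hT, hmax⟩ := hKc.exists_isMaxOn h0 (continuous_overlap R).continuousOn
        refine ⟨_, not_le.mp fun hcon => ?_, fun T' hT' => hmax hT'⟩
        rw [eq_of_one_le_overlap hρ.2.2 hT.1.1 hcon] at hT
        exact not_le.mpr ha hT.2
    have hlim : Filter.Tendsto (fun ε : ℝ => √(1 - ε ^ 2)) (𝓝[>] 0) (𝓝 1) := by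
      have : Continuous fun ε : ℝ => √(1 - ε ^ 2) := by fun_prop
      simpa using (this.tendsto 0).mono_left nhdsWithin_le_nhds
    filter_upwards [self_mem_nhdsWithin, hlim.eventually_const_lt hm] with ε hε hmε
    have hε0 : 0 ≤ ε := le_of_lt hε
    obtain ⟨τ, hτ, hmax⟩ := (isGreatest_altMinSmooth hε0 hρ).1
    rw [← hmax]
    obtain ⟨T, hT, rfl⟩ := exists_mem_nearSet hε0 le_rfl hτ
    by_contra hcon
    have hTK : T ∈ K := by
      refine ⟨⟨hT.1, ?_⟩, not_lt.mp hcon⟩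
      have : √(1 - (1 : ℝ) ^ 2) = 0 := by simp
      rw [this]
      exact (Real.sqrt_nonneg _).trans hT.2
    exact absurd (hT.2.trans (hKm T hTK)) (not_le.mpr hmε)

theorem tendsto_altMaxSmooth {T : Matrix (A × B) C ℂ} (h : IsSubnormState (T * Tᴴ)) :
    Filter.Tendsto (fun ε : ℝ => altMaxSmooth ε (T * Tᴴ)) (𝓝[>] 0) (𝓝 (-altMin (compl T))) := by
  refine ((continuous_neg.tendsto _).comp
    (tendsto_altMinSmooth (isSubnormState_compl h))).congr' ?_
  filter_upwards [self_mem_nhdsWithin] with ε hε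
  exact (altMaxSmooth_mul_conjTranspose (le_of_lt hε) h).symm

/-- Duality of the non-smooth entropies, for every purification. -/
theorem altMax_mul_conjTranspose {T : Matrix (A × B) C ℂ} (h : IsSubnormState (T * Tᴴ)) :
    altMax (T * Tᴴ) = -altMin (compl T) :=
  (tendsto_altMaxSmooth h).limUnder_eq

end

section

variable {A B C X Z : Type*} [Fintype A] [DecidableEq A] [Fintype B] [DecidableEq B]
  [Fintype C] [DecidableEq C] [Fintype X] [DecidableEq X] [Fintype Z] [DecidableEq Z]

/-! ### Support projectors -/

theorem toEuclideanCLM_supportProj (ρ : Matrix X X ℂ) :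
    toEuclideanCLM (n := X) (𝕜 := ℂ) (supportProj ρ) =
      (LinearMap.ker (toEuclideanLin ρ))ᗮ.starProjection :=
  (toEuclideanCLM (n := X) (𝕜 := ℂ)).apply_symm_apply _

theorem supportProj_conjTranspose (ρ : Matrix X X ℂ) : (supportProj ρ)ᴴ = supportProj ρ := by
  apply EquivLike.injective (toEuclideanCLM (n := X) (𝕜 := ℂ))
  rw [← star_eq_conjTranspose, map_star, toEuclideanCLM_supportProj]
  exact isSelfAdjoint_starProjection _

theorem supportProj_mul_self (ρ : Matrix X X ℂ) :
    supportProj ρ * supportProj ρ = supportProj ρ := by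
  apply EquivLike.injective (toEuclideanCLM (n := X) (𝕜 := ℂ))
  rw [map_mul, toEuclideanCLM_supportProj]
  exact Submodule.isIdempotentElem_starProjection (LinearMap.ker (toEuclideanLin ρ))ᗮ

theorem supportProj_posSemidef (ρ : Matrix X X ℂ) : (supportProj ρ).PosSemidef := by
  have := posSemidef_conjTranspose_mul_self (supportProj ρ)
  rwa [supportProj_conjTranspose, supportProj_mul_self] at this

theorem mul_supportProj (ρ : Matrix X X ℂ) : ρ * supportProj ρ = ρ := by
  apply EquivLike.injective (toEuclideanCLM (n := X) (𝕜 := ℂ))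
  refine ContinuousLinearMap.ext fun v => ?_
  rw [map_mul, toEuclideanCLM_supportProj, ContinuousLinearMap.mul_def,
    ContinuousLinearMap.comp_apply]
  have h := Submodule.sub_starProjection_mem_orthogonal
    (K := (LinearMap.ker (toEuclideanLin ρ))ᗮ) v
  rw [Submodule.orthogonal_orthogonal, LinearMap.mem_ker, map_sub, sub_eq_zero] at h
  exact h.symm

theorem exists_supportProj_eq_mul {ρ : Matrix X X ℂ} (h : ρ.IsHermitian) :
    ∃ G : Matrix X X ℂ, supportProj ρ = ρ * G := by
  have hr : (LinearMap.ker (toEuclideanLin ρ))ᗮ = LinearMap.range (toEuclideanLin ρ) := by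
    rw [← (isSymmetric_toEuclideanLin_iff.mpr h).orthogonal_range, Submodule.orthogonal_orthogonal]
  have hmem (j : X) : ∃ w : EuclideanSpace ℂ X, toEuclideanLin ρ w =
      (LinearMap.ker (toEuclideanLin ρ))ᗮ.starProjection (EuclideanSpace.single j 1) :=
    LinearMap.mem_range.mp (hr.le (Submodule.starProjection_apply_mem _ _))
  choose w hw using hmem
  refine ⟨of fun i j => w j i, ?_⟩
  ext i j
  have := congrArg (fun v : EuclideanSpace ℂ X => v i) (hw j)
  rw [← toEuclideanCLM_supportProj] at this
  simp only [toEuclideanLin, toLpLin_apply, ofLp_toEuclideanCLM] at this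
  have e : (supportProj ρ *ᵥ (EuclideanSpace.single j (1 : ℂ)).ofLp) i = supportProj ρ i j := by
    simp
  rw [e] at this
  rw [← this]
  rfl

omit [DecidableEq Z] in
/-- The support projector of `T * Tᴴ` fixes the range of `T`. -/
theorem supportProj_mul_right (T : Matrix X Z ℂ) : supportProj (T * Tᴴ) * T = T := by
  set P := supportProj (T * Tᴴ) with hP
  have hPH : Pᴴ = P := supportProj_conjTranspose _
  have h1 : T * Tᴴ * P = T * Tᴴ := mul_supportProj _
  have h2 : (T - P * T) * (T - P * T)ᴴ = 0 := by
    rw [conjTranspose_sub, conjTranspose_mul, hPH]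
    simp only [Matrix.mul_sub, Matrix.sub_mul]
    rw [← Matrix.mul_assoc T, h1, Matrix.mul_assoc P T, Matrix.mul_assoc P T (Tᴴ * P),
      ← Matrix.mul_assoc T, h1]
    simp
  exact (sub_eq_zero.mp (self_mul_conjTranspose_eq_zero.mp h2)).symm

/-! ### The formula for the non-smooth alternative max-entropy -/

omit [DecidableEq C] in
/-- The alternative min-entropy of the complementary marginal only depends on the range of the
coefficient matrix, because local operators on the purifying system act monotonically. -/
theorem altMin_compl_eq_supportProj (T : Matrix (A × B) C ℂ) :
    altMin (compl T) = altMin (compl (supportProj (T * Tᴴ))) := by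
  apply le_antisymm
  · obtain ⟨G, hG⟩ := exists_supportProj_eq_mul (posSemidef_self_mul_conjTranspose T).isHermitian
    have := altMin_le_altMin_applyOnB (Tᴴ * G)ᵀ (compl T)
    rwa [← compl_mul_transpose, transpose_transpose, ← Matrix.mul_assoc, ← hG] at this
  · have := altMin_le_altMin_applyOnB Tᵀ (compl (supportProj (T * Tᴴ)))
    rwa [← compl_mul_transpose, transpose_transpose, supportProj_mul_right] at this

/-- `N N† ≤ t` if and only if `N† N ≤ t`, by taking both Schur complements in a block matrix. -/
theorem posSemidef_smul_one_sub_comm {t : ℝ} (ht : 0 < t) (N : Matrix X Z ℂ) :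
    (t • (1 : Matrix X X ℂ) - N * Nᴴ).PosSemidef ↔
      (t • (1 : Matrix Z Z ℂ) - Nᴴ * N).PosSemidef := by
  have h1 : (t • (1 : Matrix X X ℂ)).PosDef := PosDef.one.smul ht
  have hi : (t • (1 : Matrix X X ℂ))⁻¹ = t⁻¹ • 1 := by
    apply inv_eq_left_inv
    rw [Matrix.smul_mul, Matrix.one_mul, smul_smul, inv_mul_cancel₀ ht.ne', one_smul]
  let _ : Invertible (t • (1 : Matrix X X ℂ)) := h1.isUnit.invertible
  let _ : Invertible (1 : Matrix Z Z ℂ) := invertibleOne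
  have e1 := PosDef.fromBlocks₂₂ (t • (1 : Matrix X X ℂ)) N (PosDef.one (n := Z) (R := ℂ))
  have e2 := PosDef.fromBlocks₁₁ N (1 : Matrix Z Z ℂ) h1
  rw [inv_one, Matrix.mul_one] at e1
  rw [hi, Matrix.mul_smul, Matrix.mul_one, Matrix.smul_mul] at e2
  rw [← e1, e2]
  constructor <;> intro h
  · have := h.smul ht.le
    rwa [smul_sub, smul_smul, mul_inv_cancel₀ ht.ne', one_smul] at this
  · have := h.smul (inv_nonneg.mpr ht.le)
    rwa [smul_sub, smul_smul, inv_mul_cancel₀ ht.ne', one_smul] at this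

omit [DecidableEq A] [DecidableEq B] [Fintype C] [DecidableEq C] in
theorem traceFst_compl (T : Matrix (A × B) C ℂ) :
    traceFst (compl T) = Tᵀ * (Tᵀ)ᴴ := by
  ext i j
  simp [traceFst, compl, swapBC, mul_apply, Fintype.sum_prod_type]

omit [DecidableEq A] [Fintype B] [DecidableEq B] [DecidableEq C] in
theorem swapBC_conjTranspose_mul_self (T : Matrix (A × B) C ℂ) :
    (swapBC T)ᴴ * swapBC T = (traceFst (T * Tᴴ))ᵀ := by
  ext i j
  simp [traceFst, swapBC, mul_apply, Fintype.sum_prod_type, mul_comm]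

theorem gapOp_compl_posSemidef_iff {P : Matrix (A × B) (A × B) ℂ} (hP : Pᴴ = P) (hPP : P * P = P)
    {t : ℝ} (ht : 0 < t) :
    (gapOp t (compl P)).PosSemidef ↔ (t • (1 : Matrix B B ℂ) - traceFst P).PosSemidef := by
  have hP1 : (1 - P)ᴴ = 1 - P := by rw [conjTranspose_sub, conjTranspose_one, hP]
  have hPP1 : (1 - P) * (1 - P) = 1 - P := by
    rw [Matrix.mul_sub, Matrix.sub_mul, Matrix.sub_mul, hPP]
    simp
  have hps : (1 - P).PosSemidef := by
    have := posSemidef_conjTranspose_mul_self (1 - P)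
    rwa [hP1, hPP1] at this
  have hPT : Pᵀ * (Pᵀ)ᴴ = Pᵀ := by
    rw [show (Pᵀ)ᴴ = (Pᴴ)ᵀ from rfl, hP, ← transpose_mul, hPP]
  have hgap : gapOp t (compl P) =
      t • ((1 : Matrix A A ℂ) ⊗ₖ Pᵀ) - swapBC P * (swapBC P)ᴴ := by
    rw [gapOp, traceFst_compl, hPT, compl]
  have hN : ((1 : Matrix A A ℂ) ⊗ₖ Pᵀ) * swapBC P = swapBC P := by
    rw [← swapBC_mul_transpose, transpose_transpose, hPP]
  have hJ : (1 : Matrix A A ℂ) ⊗ₖ (1 - P)ᵀ = 1 - (1 : Matrix A A ℂ) ⊗ₖ Pᵀ := by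
    rw [transpose_sub, transpose_one, eq_sub_iff_add_eq, ← kronecker_add, sub_add_cancel,
      one_kronecker_one]
  have htr : (t • (1 : Matrix B B ℂ) - traceFst P).PosSemidef ↔
      (t • (1 : Matrix B B ℂ) - (swapBC P)ᴴ * swapBC P).PosSemidef := by
    rw [swapBC_conjTranspose_mul_self, hP, hPP, ← posSemidef_transpose_iff, transpose_sub,
      transpose_smul, transpose_one]
  rw [htr, ← posSemidef_smul_one_sub_comm ht, hgap]
  constructor <;> intro h
  · have h2 := h.add ((PosSemidef.one (n := A) (R := ℂ)).kronecker hps.transpose |>.smul ht.le)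
    rw [hJ, smul_sub] at h2
    convert h2 using 1
    abel
  · have h2 := h.mul_mul_conjTranspose_same ((1 : Matrix A A ℂ) ⊗ₖ Pᵀ)
    have hH : ((1 : Matrix A A ℂ) ⊗ₖ Pᵀ)ᴴ = (1 : Matrix A A ℂ) ⊗ₖ Pᵀ := by
      rw [conjTranspose_kronecker, conjTranspose_one, show (Pᵀ)ᴴ = (Pᴴ)ᵀ from rfl, hP]
    have hI : ((1 : Matrix A A ℂ) ⊗ₖ Pᵀ) * ((1 : Matrix A A ℂ) ⊗ₖ Pᵀ) =
        (1 : Matrix A A ℂ) ⊗ₖ Pᵀ := by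
      rw [← mul_kronecker_mul, ← transpose_mul, hPP, Matrix.one_mul]
    have hN' : (swapBC P)ᴴ * ((1 : Matrix A A ℂ) ⊗ₖ Pᵀ) = (swapBC P)ᴴ := by
      have := congrArg conjTranspose hN
      rwa [conjTranspose_mul, hH] at this
    rw [hH, Matrix.mul_sub, Matrix.sub_mul, Matrix.mul_smul, Matrix.mul_one, Matrix.smul_mul, hI,
      ← Matrix.mul_assoc, hN, Matrix.mul_assoc, hN'] at h2
    exact h2

theorem re_trace_mul_nonneg {M σ : Matrix X X ℂ} (hM : M.PosSemidef) (hσ : σ.PosSemidef) :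
    0 ≤ (M * σ).trace.re := by
  have h := hM.mul_mul_conjTranspose_same (CFC.sqrt σ)
  rw [sqrt_conjTranspose] at h
  have := (Complex.nonneg_iff.mp h.trace_nonneg).1
  rwa [trace_mul_comm, ← Matrix.mul_assoc, sqrt_mul_sqrt hσ, trace_mul_comm] at this

/-- The largest eigenvalue of a Hermitian matrix is attained at a state and bounds the matrix. -/
theorem exists_isNormState_posSemidef [Nonempty X] {Q : Matrix X X ℂ} (hQ : Q.IsHermitian) :
    ∃ σ : Matrix X X ℂ, IsNormState σ ∧
      ((Q * σ).trace.re • (1 : Matrix X X ℂ) - Q).PosSemidef := by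
  obtain ⟨i₀, hi₀⟩ := Finite.exists_max hQ.eigenvalues
  set U : Matrix X X ℂ := (hQ.eigenvectorUnitary : Matrix X X ℂ) with hU
  have hUU : Uᴴ * U = 1 := Unitary.coe_star_mul_self hQ.eigenvectorUnitary
  have hUU' : U * Uᴴ = 1 := mul_eq_one_comm.mp hUU
  set d : X → ℂ := fun i => (hQ.eigenvalues i : ℂ) with hd
  have hspec : Q = U * diagonal d * Uᴴ := by
    conv_lhs => rw [hQ.spectral_theorem]
    rfl
  set e : X → ℂ := Pi.single i₀ 1 with he
  have htr : (Q * (U * diagonal e * Uᴴ)).trace = hQ.eigenvalues i₀ := by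
    have : Q * (U * diagonal e * Uᴴ) = U * (diagonal d * diagonal e * Uᴴ) := by
      conv_lhs => rw [hspec]
      simp only [Matrix.mul_assoc]
      rw [← Matrix.mul_assoc Uᴴ U, hUU, Matrix.one_mul]
    rw [this, trace_mul_comm, Matrix.mul_assoc, hUU, Matrix.mul_one, diagonal_mul_diagonal,
      trace_diagonal]
    simp [he, hd, Pi.single_apply]
  refine ⟨U * diagonal e * Uᴴ, ⟨?_, ?_⟩, ?_⟩
  · refine PosSemidef.mul_mul_conjTranspose_same (posSemidef_diagonal_iff.mpr fun i => ?_) U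
    rw [he, Pi.single_apply]
    split_ifs <;> simp
  · rw [trace_mul_comm, ← Matrix.mul_assoc, hUU, Matrix.one_mul, trace_diagonal]
    simp [he]
  · rw [htr, Complex.ofReal_re]
    have : hQ.eigenvalues i₀ • (1 : Matrix X X ℂ) - Q =
        U * diagonal (fun i => ((hQ.eigenvalues i₀ - hQ.eigenvalues i : ℝ) : ℂ)) * Uᴴ := by
      have h1 : diagonal (fun i => ((hQ.eigenvalues i₀ - hQ.eigenvalues i : ℝ) : ℂ)) =
          hQ.eigenvalues i₀ • (1 : Matrix X X ℂ) - diagonal d := by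
        ext i j
        by_cases h : i = j
        · subst h; simp [hd]
        · simp [h]
      rw [h1, Matrix.mul_sub, Matrix.sub_mul, Matrix.mul_smul, Matrix.mul_one, Matrix.smul_mul,
        hUU', ← hspec]
    rw [this]
    refine PosSemidef.mul_mul_conjTranspose_same (posSemidef_diagonal_iff.mpr fun i => ?_) U
    exact Complex.zero_le_real.mpr (sub_nonneg.mpr (hi₀ i))

omit [DecidableEq B] in
theorem trace_mul_one_kronecker (M : Matrix (A × B) (A × B) ℂ) (σ : Matrix B B ℂ) :
    (M * ((1 : Matrix A A ℂ) ⊗ₖ σ)).trace = (traceFst M * σ).trace := by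
  have : traceFst (M * ((1 : Matrix A A ℂ) ⊗ₖ σ)) = traceFst M * σ := by
    ext i j
    simp only [traceFst, of_apply, mul_apply, kroneckerMap_apply, Fintype.sum_prod_type, one_apply,
      ite_mul, one_mul, zero_mul, mul_ite, mul_zero, Finset.sum_ite_irrel, Finset.sum_const_zero,
      Finset.sum_ite_eq', Finset.mem_univ, if_true, Finset.sum_mul]
    exact Finset.sum_comm
  rw [← this, trace_traceFst]

theorem trace_supportProj_pos {ρ : Matrix X X ℂ} (h : 0 < ρ.trace.re) :
    0 < (supportProj ρ).trace.re := by
  refine re_trace_pos_of_ne_zero (supportProj_posSemidef ρ) fun h0 => ?_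
  have h1 := mul_supportProj ρ
  rw [h0, Matrix.mul_zero] at h1
  rw [← h1] at h
  simp at h

theorem altMax_eq_neg_altMin_compl {ρ : Matrix (A × B) (A × B) ℂ} (hρ : IsSubnormState ρ) :
    altMax ρ = -altMin (compl (supportProj ρ)) := by
  obtain ⟨T, rfl⟩ := exists_mul_conjTranspose_eq (Z := A × B) le_rfl hρ.1
  rw [altMax_mul_conjTranspose hρ, altMin_compl_eq_supportProj]

theorem altMax_le_of_posSemidef {ρ : Matrix (A × B) (A × B) ℂ} (hρ : IsSubnormState ρ) {l : ℝ}
    (h : ((2 : ℝ) ^ l • (1 : Matrix B B ℂ) - traceFst (supportProj ρ)).PosSemidef) :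
    altMax ρ ≤ l := by
  rw [altMax_eq_neg_altMin_compl hρ, EReal.neg_le, ← EReal.coe_neg]
  apply le_altMin
  rw [neg_neg]
  exact (gapOp_compl_posSemidef_iff (supportProj_conjTranspose ρ) (supportProj_mul_self ρ)
    (by positivity)).mpr h

/-- Every state `σ` on `B` gives a lower bound on the alternative max-entropy. -/
theorem log2_le_altMax {ρ : Matrix (A × B) (A × B) ℂ} (hρ : IsSubnormState ρ)
    {σ : Matrix B B ℂ} (hσ : IsNormState σ) :
    log2 (supportProj ρ * ((1 : Matrix A A ℂ) ⊗ₖ σ)).trace.re ≤ altMax ρ := by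
  rw [altMax_eq_neg_altMin_compl hρ, EReal.le_neg]
  refine altMin_le_of_forall fun l hl => ?_
  rw [neg_neg, log2]
  split_ifs with h0
  · exact bot_le
  · rw [EReal.coe_le_coe_iff, Real.logb_le_iff_le_rpow one_lt_two (not_le.mp h0)]
    have h1 := (gapOp_compl_posSemidef_iff (supportProj_conjTranspose ρ) (supportProj_mul_self ρ)
      (by positivity)).mp hl
    have h2 := re_trace_mul_nonneg h1 hσ.1
    rw [Matrix.sub_mul, Matrix.smul_mul, Matrix.one_mul, trace_sub, trace_smul, hσ.2,
      ← trace_mul_one_kronecker] at h2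
    simpa using h2

theorem isGreatest_altMax {ρ : Matrix (A × B) (A × B) ℂ} (hρ : IsSubnormState ρ) :
    IsGreatest
      {x : EReal | ∃ σ : Matrix B B ℂ, IsNormState σ ∧
        x = log2 (supportProj ρ * ((1 : Matrix A A ℂ) ⊗ₖ σ)).trace.re}
      (altMax ρ) := by
  have hB : Nonempty B := hρ.nonempty.map Prod.snd
  refine ⟨?_, by rintro _ ⟨σ, hσ, rfl⟩; exact log2_le_altMax hρ hσ⟩
  obtain ⟨σ, hσ, hq⟩ := exists_isNormState_posSemidef
    (traceFst_posSemidef (supportProj_posSemidef ρ)).isHermitian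
  refine ⟨σ, hσ, le_antisymm ?_ (log2_le_altMax hρ hσ)⟩
  rw [trace_mul_one_kronecker]
  have hpos : 0 < (traceFst (supportProj ρ) * σ).trace.re := by
    by_contra hcon
    have h1 := (Complex.nonneg_iff.mp hq.trace_nonneg).1
    have h2 := trace_supportProj_pos hρ.2.1
    rw [trace_sub, trace_smul, trace_one, trace_traceFst] at h1
    simp only [Complex.sub_re, Complex.smul_re, Complex.natCast_re, smul_eq_mul] at h1
    have h3 : (0 : ℝ) ≤ Fintype.card B := by positivity
    nlinarith
  rw [log2, if_neg (not_le.mpr hpos)]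
  apply altMax_le_of_posSemidef hρ
  rwa [Real.rpow_logb two_pos (by norm_num) hpos]

end

section

variable {A B C D X Z : Type*} [Fintype A] [DecidableEq A] [Fintype B] [DecidableEq B]
  [Fintype C] [DecidableEq C] [Fintype D] [DecidableEq D] [Fintype X] [DecidableEq X]
  [Fintype Z] [DecidableEq Z]

/-! ### Duality between smoothing on `AB` and smoothing on `AC` -/

theorem altMaxSmooth_applyOnB {ε : ℝ} (hε : 0 ≤ ε) {U : Matrix D B ℂ} (hU : IsIsometry U)
    {ρ : Matrix (A × B) (A × B) ℂ} (hρ : IsSubnormState ρ) :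
    altMaxSmooth ε (applyOnB U ρ) = altMaxSmooth ε ρ := by
  obtain ⟨T, rfl⟩ := exists_mul_conjTranspose_eq (Z := A × B) le_rfl hρ.1
  have h := hρ.applyOnB hU
  rw [applyOnB_mul_conjTranspose] at h ⊢
  rw [altMaxSmooth_mul_conjTranspose hε h, altMaxSmooth_mul_conjTranspose hε hρ,
    compl_one_kronecker_mul hU]

/-- A state near `ρ_AB` has, by Uhlmann's theorem, a purification whose marginal on `AC` is near
`ρ_AC`. -/
theorem altMaxSmooth_le_altMax {ε : ℝ} (hε : 0 ≤ ε) {ρ τ : Matrix (A × B) (A × B) ℂ}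
    (hρ : IsSubnormState ρ) (hτ : τ ∈ epsBall ε ρ) : altMaxSmooth ε ρ ≤ altMax τ := by
  obtain ⟨R, rfl⟩ := exists_mul_conjTranspose_eq (Z := A × B) le_rfl hρ.1
  obtain ⟨T, hT, rfl⟩ := exists_mem_nearSet hε le_rfl hτ
  rw [altMaxSmooth_mul_conjTranspose hε hρ, altMax_mul_conjTranspose hτ.1, EReal.neg_le_neg_iff]
  exact le_sSup ⟨_, compl_mem_epsBall hε hT hτ.1.2.1, rfl⟩

/-- If `B` is large enough to purify states on `AC`, the optimal state near `ρ_AC` is the marginal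
of a pure state whose marginal on `AB` is near `ρ_AB`. -/
theorem exists_altMax_eq_altMaxSmooth {ε : ℝ} (hε : 0 ≤ ε) {R : Matrix (A × B) C ℂ}
    (hR : IsSubnormState (R * Rᴴ)) (hc : Fintype.card A * Fintype.card C ≤ Fintype.card B) :
    ∃ τ ∈ epsBall ε (R * Rᴴ), altMax τ = altMaxSmooth ε (R * Rᴴ) := by
  obtain ⟨⟨τ, hτ, hmax⟩, -⟩ := isGreatest_altMinSmooth hε (isSubnormState_compl hR)
  rw [← Fintype.card_prod] at hc
  obtain ⟨T', hT', hT'τ⟩ := exists_mem_nearSet (R := swapBC R) hε hc hτ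
  set T : Matrix (A × B) C ℂ := swapBC T' with hT
  have hcompl : compl T = τ := by rw [compl, hT, swapBC_swapBC, hT'τ]
  have hmem : T ∈ nearSet ε R := by
    have := swapBC_mem_nearSet hT'
    rwa [swapBC_swapBC] at this
  have hpos : 0 < (T * Tᴴ).trace.re := by
    rw [← trace_compl, hcompl]
    exact hτ.1.2.1
  have hball := mul_conjTranspose_mem_epsBall hε hmem hpos
  refine ⟨_, hball, ?_⟩
  rw [altMax_mul_conjTranspose hball.1, hcompl, hmax, altMaxSmooth_mul_conjTranspose hε hR]

/-- The columns of this purification are indexed by the nonzero eigenvalues. -/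
theorem exists_purification_nonzero_eigenvalues {ρ : Matrix X X ℂ} (h : ρ.PosSemidef) :
    ∃ R : Matrix X {i // h.isHermitian.eigenvalues i ≠ 0} ℂ, R * Rᴴ = ρ := by
  set lam := h.isHermitian.eigenvalues with hlam
  set U : Matrix X X ℂ := (h.isHermitian.eigenvectorUnitary : Matrix X X ℂ) with hU
  have hspec : ρ = U * diagonal (fun i => (lam i : ℂ)) * Uᴴ := by
    conv_lhs => rw [h.isHermitian.spectral_theorem]
    rfl
  refine ⟨of fun x i => U x i * (√(lam i) : ℝ), ?_⟩
  ext x y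
  have hsq (i : X) : ((√(lam i) : ℝ) : ℂ) * ((√(lam i) : ℝ) : ℂ) = (lam i : ℂ) := by
    rw [← Complex.ofReal_mul, Real.mul_self_sqrt (h.eigenvalues_nonneg i)]
  have h1 : ρ x y = ∑ i, U x i * lam i * star (U y i) := by
    conv_lhs => rw [hspec]
    rw [mul_apply]
    simp only [mul_diagonal, conjTranspose_apply]
  have h2 : ∑ i : {i // lam i ≠ 0}, U x i * lam i * star (U y i) =
      ∑ i, U x i * lam i * star (U y i) := by
    rw [← Finset.sum_subtype (Finset.univ.filter fun i => lam i ≠ 0) (by simp)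
      fun i => U x i * lam i * star (U y i)]
    refine Finset.sum_filter_of_ne fun i _ hne h0 => hne ?_
    rw [h0, Complex.ofReal_zero, mul_zero, zero_mul]
  rw [h1, ← h2, mul_apply]
  refine Finset.sum_congr rfl fun i _ => ?_
  rw [conjTranspose_apply, of_apply, of_apply, star_mul', ← hsq]
  simp
  ring

theorem exists_altMax_eq_altMaxSmooth_applyOnB {ε : ℝ} (hε : 0 ≤ ε) {V : Matrix D B ℂ}
    (hV : IsIsometry V) {ρ : Matrix (A × B) (A × B) ℂ} (hρ : IsSubnormState ρ)
    (hc : ρ.rank * Fintype.card A ≤ Fintype.card D) :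
    ∃ τ ∈ epsBall ε (applyOnB V ρ), altMax τ = altMaxSmooth ε ρ := by
  obtain ⟨R, hR⟩ := exists_purification_nonzero_eigenvalues hρ.1
  rw [hρ.1.isHermitian.rank_eq_card_non_zero_eigs, mul_comm] at hc
  have h := hρ.applyOnB hV
  rw [← altMaxSmooth_applyOnB hε hV hρ]
  rw [← hR, applyOnB_mul_conjTranspose] at h ⊢
  exact exists_altMax_eq_altMaxSmooth hε h hc

/-! ### Attainment of the minimum over the ball -/

omit [DecidableEq A] [Fintype A] [DecidableEq B] [DecidableEq C] [Fintype C] in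
theorem continuous_compl :
    Continuous (compl : Matrix (A × B) C ℂ → Matrix (A × C) (A × C) ℂ) := by
  have : Continuous (swapBC : Matrix (A × B) C ℂ → Matrix (A × C) B ℂ) :=
    continuous_matrix fun p b => by
      simp only [swapBC, of_apply]
      fun_prop
  exact this.matrix_mul this.matrix_conjTranspose

theorem one_le_trace_supportProj {ρ : Matrix X X ℂ} (h : 0 < ρ.trace.re) :
    1 ≤ (supportProj ρ).trace.re := by
  have hi : IsIdempotentElem (toLin' (supportProj ρ)) := by
    rw [IsIdempotentElem, Module.End.mul_eq_comp, ← toLin'_mul, supportProj_mul_self]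
  have h1 := (LinearMap.IsIdempotentElem.isProj_range _ hi).trace
  rw [trace_toLin'_eq] at h1
  have h2 := trace_supportProj_pos h
  rw [h1, Complex.natCast_re] at h2 ⊢
  exact_mod_cast h2

theorem neg_logb_card_fst_le_altMax {ρ : Matrix (A × B) (A × B) ℂ} (hρ : IsSubnormState ρ) :
    ((-Real.logb 2 (Fintype.card A) : ℝ) : EReal) ≤ altMax ρ := by
  obtain ⟨T, rfl⟩ := exists_mul_conjTranspose_eq (Z := A × B) le_rfl hρ.1
  rw [altMax_mul_conjTranspose hρ, EReal.coe_neg, EReal.neg_le_neg_iff]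
  exact altMin_le_logb_card (isSubnormState_compl hρ).2.1

/-- The bound comes from the maximally mixed state on `B`. -/
theorem neg_logb_card_snd_le_altMax {ρ : Matrix (A × B) (A × B) ℂ} (hρ : IsSubnormState ρ) :
    ((-Real.logb 2 (Fintype.card B) : ℝ) : EReal) ≤ altMax ρ := by
  have hB : Nonempty B := hρ.nonempty.map Prod.snd
  have hb : (0 : ℝ) < Fintype.card B := by exact_mod_cast Fintype.card_pos
  have hσ : IsNormState ((Fintype.card B : ℝ)⁻¹ • (1 : Matrix B B ℂ)) := by
    refine ⟨PosSemidef.one.smul (by positivity), ?_⟩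
    rw [trace_smul, trace_one, Complex.real_smul, Complex.ofReal_inv, Complex.ofReal_natCast]
    exact inv_mul_cancel₀ (by exact_mod_cast hb.ne')
  refine le_trans ?_ (log2_le_altMax hρ hσ)
  have h1 := one_le_trace_supportProj hρ.2.1
  have e : (supportProj ρ * ((1 : Matrix A A ℂ) ⊗ₖ
      ((Fintype.card B : ℝ)⁻¹ • (1 : Matrix B B ℂ)))).trace.re =
      (Fintype.card B : ℝ)⁻¹ * (supportProj ρ).trace.re := by
    rw [kronecker_smul, one_kronecker_one, Matrix.mul_smul, Matrix.mul_one, trace_smul,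
      Complex.smul_re, smul_eq_mul]
  have hpos : 0 < (Fintype.card B : ℝ)⁻¹ * (supportProj ρ).trace.re := by positivity
  rw [e, log2, if_neg (not_le.mpr hpos), EReal.coe_le_coe_iff, ← Real.logb_inv]
  apply Real.logb_le_logb_of_le one_lt_two (by positivity)
  exact le_mul_of_one_le_right (by positivity) h1

/-- The phase `u` in a polar decomposition of `W`, extended to be an isometry or a coisometry: a
maximally entangled vector that is not orthogonal to `W`. -/
theorem exists_partial_isometry_re_trace_pos {W : Matrix A B ℂ} (hW : W ≠ 0) :
    ∃ u : Matrix A B ℂ, 0 < (Wᴴ * u).trace.re ∧ (1 - u * uᴴ).PosSemidef ∧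
      (u * uᴴ).trace = (min (Fintype.card A) (Fintype.card B) : ℕ) := by
  rcases le_total (Fintype.card A) (Fintype.card B) with hc | hc
  · obtain ⟨u, hu, h⟩ := exists_eq_sqrt_mul_coisometry hc W
    refine ⟨u, ?_, by rw [hu, sub_self]; exact PosSemidef.zero,
      by rw [hu, trace_one, min_eq_left hc]⟩
    have e : (Wᴴ * u).trace = (CFC.sqrt (W * Wᴴ)).trace := by
      conv_lhs => rw [h]
      rw [conjTranspose_mul, sqrt_conjTranspose, trace_mul_comm, ← Matrix.mul_assoc, hu,
        Matrix.one_mul]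
    rw [e]
    exact re_trace_pos_of_ne_zero (sqrt_posSemidef _) (sqrt_ne_zero
      (posSemidef_self_mul_conjTranspose W) fun h0 => hW (self_mul_conjTranspose_eq_zero.mp h0))
  · obtain ⟨v, hv, h⟩ := exists_eq_sqrt_mul_coisometry hc Wᴴ
    refine ⟨vᴴ, ?_, ?_, ?_⟩
    · have e : (Wᴴ * vᴴ).trace = (CFC.sqrt (Wᴴ * Wᴴᴴ)).trace := by
        conv_lhs => rw [h]
        rw [Matrix.mul_assoc, hv, Matrix.mul_one]
      rw [e]
      refine re_trace_pos_of_ne_zero (sqrt_posSemidef _) (sqrt_ne_zero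
        (posSemidef_self_mul_conjTranspose _) fun h0 => hW ?_)
      rw [← conjTranspose_eq_zero]
      exact self_mul_conjTranspose_eq_zero.mp h0
    · have h1 : (1 - vᴴ * v)ᴴ * (1 - vᴴ * v) = 1 - vᴴ * v := by
        rw [conjTranspose_sub, conjTranspose_one, conjTranspose_mul, conjTranspose_conjTranspose,
          Matrix.mul_sub, Matrix.sub_mul, Matrix.sub_mul, Matrix.mul_assoc vᴴ v (vᴴ * v),
          ← Matrix.mul_assoc v, hv]
        simp
      rw [conjTranspose_conjTranspose, ← h1]
      exact posSemidef_conjTranspose_mul_self _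
    · rw [conjTranspose_conjTranspose, trace_mul_comm, hv, trace_one, min_eq_right hc]

/-- A large ball contains a multiple of a maximally entangled pure state, for which the alternative
max-entropy is as small as it can be. -/
theorem exists_mem_epsBall_altMax_le {ε : ℝ} (hε : 0 ≤ ε) {ρ : Matrix (A × B) (A × B) ℂ}
    (hρ : IsSubnormState ρ) (h : ρ.trace.re ≤ ε ^ 2) :
    ∃ τ ∈ epsBall ε ρ, altMax τ ≤
      ((-Real.logb 2 (min (Fintype.card A) (Fintype.card B) : ℕ) : ℝ) : EReal) := by
  obtain ⟨R, rfl⟩ := exists_mul_conjTranspose_eq (Z := A × B) le_rfl hρ.1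
  have hR0 : R ≠ 0 := by
    rintro rfl
    have := hρ.2.1
    simp at this
  obtain ⟨z, hz⟩ : ∃ z, (of fun a b => R (a, b) z : Matrix A B ℂ) ≠ 0 := by
    by_contra! hcon
    refine hR0 ?_
    ext ⟨a, b⟩ z
    exact congrFun (congrFun (hcon z) a) b
  obtain ⟨u, hu, hu1, hutr⟩ := exists_partial_isometry_re_trace_pos hz
  -- the pure state `u`, once with purifying system `AB` like `R`, once with a trivial one
  set T : Matrix (A × B) (A × B) ℂ := of fun x z' => if z' = z then u x.1 x.2 else 0 with hT
  set T₁ : Matrix (A × B) Unit ℂ := of fun x _ => u x.1 x.2 with hT₁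
  have hTT : T * Tᴴ = T₁ * T₁ᴴ := by
    ext x y
    simp [hT, hT₁, mul_apply]
  have hin : (Rᴴ * T).trace.re = ((of fun a b => R (a, b) z : Matrix A B ℂ)ᴴ * u).trace.re := by
    congr 1
    simp only [trace, diag_apply, mul_apply, hT, of_apply, conjTranspose_apply, mul_ite, mul_zero]
    rw [Finset.sum_eq_single z (fun z' _ hz' => by simp [hz']) (by simp)]
    simp only [if_true, Fintype.sum_prod_type]
    exact Finset.sum_comm
  obtain ⟨s, hs, hmem⟩ := exists_smul_mem_epsBall hε (T := T) hρ.2.2 h (by rw [hin]; exact hu)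
  refine ⟨_, hmem, ?_⟩
  have hss : s • (T * Tᴴ) = (√s • T₁) * (√s • T₁)ᴴ := by
    rw [hTT, conjTranspose_smul, star_trivial, Matrix.smul_mul, Matrix.mul_smul, smul_smul,
      Real.mul_self_sqrt hs.le]
  have hcs : compl (√s • T₁) = s • compl T₁ := by
    have : swapBC (√s • T₁) = √s • swapBC T₁ := rfl
    rw [compl, compl, this, conjTranspose_smul, star_trivial, Matrix.smul_mul, Matrix.mul_smul,
      smul_smul, Real.mul_self_sqrt hs.le]
  have hsub := hmem.1
  rw [hss] at hsub ⊢
  rw [altMax_mul_conjTranspose hsub, hcs, altMin_smul hs, EReal.coe_neg, EReal.neg_le_neg_iff]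
  apply le_altMin
  have hAB := hρ.nonempty
  have hA : Nonempty A := hAB.map Prod.fst
  have hB : Nonempty B := hAB.map Prod.snd
  have hm : (0 : ℝ) < (min (Fintype.card A) (Fintype.card B) : ℕ) := by
    exact_mod_cast lt_min Fintype.card_pos Fintype.card_pos
  rw [Real.rpow_neg zero_le_two, Real.rpow_logb two_pos (by norm_num) hm]
  set m : ℕ := min (Fintype.card A) (Fintype.card B) with hmdef
  have hgap : gapOp ((m : ℝ)⁻¹) (compl T₁) = (1 - u * uᴴ).submatrix Prod.fst Prod.fst := by
    ext ⟨a, c⟩ ⟨a', c'⟩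
    have htr : ∑ x, ∑ y, u x y * star (u x y) = (m : ℂ) := by
      rw [← hutr]
      simp [trace, mul_apply]
    have hm' : (m : ℂ) ≠ 0 := by exact_mod_cast hm.ne'
    by_cases haa : a = a'
    · subst haa
      simp only [gapOp, traceFst, compl, swapBC, hT₁, Matrix.sub_apply, Matrix.smul_apply,
        kroneckerMap_apply, of_apply, one_apply, mul_apply, conjTranspose_apply, submatrix_apply,
        htr, if_true, one_mul]
      rw [Complex.real_smul]
      simp [hm']
    · simp [gapOp, traceFst, compl, swapBC, hT₁, mul_apply, one_apply, haa]
  rw [hgap]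
  exact hu1.submatrix _

theorem exists_forall_altMax_le {ε : ℝ} (hε : 0 ≤ ε) {ρ : Matrix (A × B) (A × B) ℂ}
    (hρ : IsSubnormState ρ) : ∃ τ ∈ epsBall ε ρ, ∀ τ' ∈ epsBall ε ρ, altMax τ ≤ altMax τ' := by
  by_cases h : ρ.trace.re ≤ ε ^ 2
  · obtain ⟨τ, hτ, hl⟩ := exists_mem_epsBall_altMax_le hε hρ h
    refine ⟨τ, hτ, fun τ' hτ' => hl.trans ?_⟩
    rcases min_choice (Fintype.card A) (Fintype.card B) with hm | hm <;> rw [hm]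
    · exact neg_logb_card_fst_le_altMax hτ'.1
    · exact neg_logb_card_snd_le_altMax hτ'.1
  · obtain ⟨R, rfl⟩ := exists_mul_conjTranspose_eq (Z := A × B) le_rfl hρ.1
    obtain ⟨T, hT, hmax⟩ := UpperSemicontinuousOn.exists_isMaxOn
      (f := fun T : Matrix (A × B) (A × B) ℂ => altMin (compl T))
      ⟨R, self_mem_nearSet (ε := ε) hρ.2.2⟩ (isCompact_nearSet ε R)
      ((upperSemicontinuous_altMin_comp continuous_compl
        fun T => posSemidef_self_mul_conjTranspose _).upperSemicontinuousOn _)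
    have hball := mul_conjTranspose_mem_epsBall hε hT
      (re_trace_pos_of_mem_nearSet hρ.2.2 (not_le.mp h) hT)
    refine ⟨_, hball, fun τ' hτ' => ?_⟩
    obtain ⟨T', hT', rfl⟩ := exists_mem_nearSet hε le_rfl hτ'
    rw [altMax_mul_conjTranspose hball.1, altMax_mul_conjTranspose hτ'.1, EReal.neg_le_neg_iff]
    exact hmax hT'

theorem isLeast_altMaxBall {ε : ℝ} (hε : 0 ≤ ε) {ρ : Matrix (A × B) (A × B) ℂ}
    (hρ : IsSubnormState ρ) : IsLeast (altMax '' epsBall ε ρ) (altMaxBall ε ρ) := by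
  obtain ⟨τ, hτ, hmin⟩ := exists_forall_altMax_le hε hρ
  have h : IsLeast (altMax '' epsBall ε ρ) (altMax τ) :=
    ⟨⟨τ, hτ, rfl⟩, by rintro _ ⟨τ', hτ', rfl⟩; exact hmin τ' hτ'⟩
  rwa [altMaxBall, h.isGLB.sInf_eq]

theorem altMaxSmooth_le_altMaxBall {ε : ℝ} (hε : 0 ≤ ε) {V : Matrix D B ℂ} (hV : IsIsometry V)
    {ρ : Matrix (A × B) (A × B) ℂ} (hρ : IsSubnormState ρ) :
    altMaxSmooth ε ρ ≤ altMaxBall ε (applyOnB V ρ) := by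
  rw [← altMaxSmooth_applyOnB hε hV hρ]
  refine le_sInf ?_
  rintro _ ⟨τ, hτ, rfl⟩
  exact altMaxSmooth_le_altMax hε (hρ.applyOnB hV) hτ

theorem altMaxSmooth_eq_altMaxBall {ε : ℝ} (hε : 0 ≤ ε) {V : Matrix D B ℂ} (hV : IsIsometry V)
    {ρ : Matrix (A × B) (A × B) ℂ} (hρ : IsSubnormState ρ)
    (hc : ρ.rank * Fintype.card A ≤ Fintype.card D) :
    altMaxSmooth ε ρ = altMaxBall ε (applyOnB V ρ) := by
  refine le_antisymm (altMaxSmooth_le_altMaxBall hε hV hρ) ?_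
  obtain ⟨τ, hτ, h⟩ := exists_altMax_eq_altMaxSmooth_applyOnB hε hV hρ hc
  exact h ▸ sInf_le ⟨τ, hτ, rfl⟩

end

end QEntropy

open QEntropy in
theorem mainTheorem10 {A B : Type*} [Fintype A] [DecidableEq A] [Fintype B] [DecidableEq B]
    (ρ : Matrix (A × B) (A × B) ℂ) (hρ : IsSubnormState ρ) :
    -- the optima and limits in the definitions exist, and the choice of purification is irrelevant
    (∀ ε : ℝ, 0 ≤ ε → IsGreatest (altMin '' epsBall ε ρ) (altMinSmooth ε ρ)) ∧
    (∀ ε : ℝ, 0 ≤ ε → ∀ (C : Type*) [Fintype C] [DecidableEq C] (ψ : (A × B) × C → ℂ),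
      IsPurification ψ ρ → altMaxSmooth ε ρ = - altMinSmooth ε (traceMid (pureOp ψ))) ∧
    Filter.Tendsto (fun ε : ℝ => altMaxSmooth ε ρ) (𝓝[>] 0) (𝓝 (altMax ρ)) ∧
    -- invariance under isometries on the second system
    (∀ ε : ℝ, 0 ≤ ε → ∀ (D : Type*) [Fintype D] [DecidableEq D] (U : Matrix D B ℂ),
      IsIsometry U →
        altMinSmooth ε ρ = altMinSmooth ε (applyOnB U ρ) ∧
        altMaxSmooth ε ρ = altMaxSmooth ε (applyOnB U ρ)) ∧
    -- formula for the non-smooth alternative max-entropy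
    IsGreatest
      {x : EReal | ∃ σ : Matrix B B ℂ, IsNormState σ ∧
        x = log2 (supportProj ρ * ((1 : Matrix A A ℂ) ⊗ₖ σ)).trace.re}
      (altMax ρ) ∧
    -- formula for the smooth alternative max-entropy
    (∀ ε : ℝ, 0 ≤ ε →
      (∀ (B' : Type*) [Fintype B'] [DecidableEq B'] (V : Matrix B' B ℂ), IsIsometry V →
        IsLeast (altMax '' epsBall ε (applyOnB V ρ)) (altMaxBall ε (applyOnB V ρ)) ∧
        altMaxSmooth ε ρ ≤ altMaxBall ε (applyOnB V ρ) ∧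
        (ρ.rank * Fintype.card A ≤ Fintype.card B' →
          altMaxSmooth ε ρ = altMaxBall ε (applyOnB V ρ))) ∧
      altMaxSmooth ε ρ =
        ⨅ (n : ℕ) (V : Matrix (Fin n) B ℂ) (_ : IsIsometry V),
          altMaxBall ε (applyOnB V ρ)) := by
  refine ⟨fun ε hε => isGreatest_altMinSmooth hε hρ, ?_, ?_, ?_, isGreatest_altMax hρ, ?_⟩
  · intro ε hε C _ _ ψ hψ
    rw [IsPurification, traceSnd_pureOp] at hψ
    rw [traceMid_pureOp, ← altMaxSmooth_mul_conjTranspose hε (by rwa [hψ]), hψ]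
  · obtain ⟨T, rfl⟩ := exists_mul_conjTranspose_eq (Z := A × B) le_rfl hρ.1
    rw [altMax_mul_conjTranspose hρ]
    exact tendsto_altMaxSmooth hρ
  · intro ε hε D _ _ U hU
    exact ⟨(altMinSmooth_applyOnB hε hU hρ).symm, (altMaxSmooth_applyOnB hε hU hρ).symm⟩
  · intro ε hε
    refine ⟨fun B' _ _ V hV => ⟨isLeast_altMaxBall hε (hρ.applyOnB hV),
      altMaxSmooth_le_altMaxBall hε hV hρ, altMaxSmooth_eq_altMaxBall hε hV hρ⟩, ?_⟩
    refine le_antisymm (le_iInf fun n => le_iInf₂ fun V hV =>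
      altMaxSmooth_le_altMaxBall hε hV hρ) ?_
    obtain ⟨V, hV⟩ := exists_isIsometry (X := B)
      (Y := Fin (ρ.rank * Fintype.card A + Fintype.card B)) (by simp)
    refine (iInf_le _ (ρ.rank * Fintype.card A + Fintype.card B)).trans
      ((iInf₂_le V hV).trans ?_)
    exact (altMaxSmooth_eq_altMaxBall hε hV hρ (by simp)).ge
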